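/- Let $K/k$ be a field extension and $A$ a (finite-dimensional) central simple $K$-algebra. Definitions. For a field extension $L/k$, let $\mathrm{Rad}_k(L)$ be the group of all $x\in L^\times$ of finite order modulo $k^\times$; $L/k$ is called radical if $L=k(\mathrm{Rad}_k(L))$. A central simple $K$-algebra $B$ is radical over $k$ if it is a crossed product $B=\bigoplus_{\sigma\in \mathrm{Gal}(L/K)}Lu_\sigma$ with $u_\sigma x=\sigma(x)u_\sigma$ $(x\in L)$ and $u_\sigma u_\tau=t(\sigma,\tau)u_{\sigma\tau}$, where $L/K$ is a finite Galois extension such that $L/k$ is radical and $t$ is a $2$-cocycle with all values in $\mathrm{Rad}_k(L)$. It is radical abelian over $k$ if moreover $L/K$ can be chosen with $\mathrm{Gal}(L/K)$ abelian. A group $\Gamma$ is supersolvable if it has a finite series $1=N_0\le N_1\le\dots\le N_n=\Gamma$ of normal subgroups of $\Gamma$ with every $N_{i+1}/N_i$ cyclic. A subgroup $\Gamma\le A^\times$ is finite modulo $k^\times$ if $[\Gamma:\Gamma\cap k^\times]<\infty$. (a) If $K/k$ is finite and $A$ is radical over $k$, then $A$ is generated as a $k$-algebra by a supersolvable group of units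 that is finite modulo $k^\times$. (b) If $A$ is generated as a $k$-algebra by a supersolvable group of units that is finite modulo $k^\times$, then there are $n\ge 1$ and a central simple $K$-algebra $C$, radical abelian over $k$, such that $A\cong M_n(C)$ as $K$-algebras. -/

import Mathlib

universe u v w

/-- `G` is supersolvable: there is a finite series `1 = N 0 ≤ N 1 ≤ ... ≤ N n = G` of subgroups,
each normal in the whole group `G`, with all the quotients `N (i + 1) / N i` cyclic
(finite or infinite). -/
def IsSupersolvable (G : Type*) [Group G] : Prop :=
  ∃ (n : ℕ) (N : ℕ → Subgroup G) (_ : ∀ i, (N i).Normal),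
    N 0 = ⊥ ∧ N n = ⊤ ∧
      ∀ i < n, N i ≤ N (i + 1) ∧ IsCyclic (N (i + 1) ⧸ (N i).subgroupOf (N (i + 1)))

/-- The image of `k^×` in the group of units of a `k`-algebra `A`. -/
def scalarUnits (k A : Type*) [Field k] [Ring A] [Algebra k A] : Subgroup Aˣ :=
  (Units.map (algebraMap k A : k →* A)).range

/-- `A` is generated, as a `k`-algebra, by a supersolvable group of units `Γ` which is finite
modulo `k^×`, i.e. `[Γ : Γ ∩ k^×] < ∞`. -/
def IsGeneratedBySupersolvable (k A : Type*) [Field k] [Ring A] [Algebra k A] : Prop :=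
  ∃ Γ : Subgroup Aˣ, IsSupersolvable Γ ∧ ((scalarUnits k A).subgroupOf Γ).FiniteIndex ∧
    Algebra.adjoin k (Units.val '' (Γ : Set Aˣ)) = ⊤

/-- `Rad_k(L)`: the group of units of `L` that are of finite order modulo `k^×`. -/
def radGroup (k L : Type*) [Field k] [Field L] [Algebra k L] : Subgroup Lˣ where
  carrier := {x | ∃ n : ℕ, 0 < n ∧ x ^ n ∈ scalarUnits k L}
  one_mem' := ⟨1, one_pos, by simp⟩
  mul_mem' := by
    rintro x y ⟨m, hm, hx⟩ ⟨n, hn, hy⟩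
    refine ⟨m * n, Nat.mul_pos hm hn, ?_⟩
    rw [mul_pow, pow_mul, mul_comm m n, pow_mul y]
    exact mul_mem (pow_mem hx n) (pow_mem hy m)
  inv_mem' := by
    rintro x ⟨m, hm, hx⟩
    exact ⟨m, hm, by rw [inv_pow]; exact inv_mem hx⟩

/-- `L/k` is a radical extension: `L = k(Rad_k(L))`. -/
def IsRadicalExtension (k L : Type*) [Field k] [Field L] [Algebra k L] : Prop :=
  IntermediateField.adjoin k (Units.val '' (radGroup k L : Set Lˣ)) = ⊤

/-- The `K`-algebra `A` is the crossed product `(L/K, t) = ⊕_σ L u_σ` of the finite Galois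
extension `L/K` and the 2-cocycle `t`: it contains `L` (through `ι`) and units `u_σ`, one for each
`σ ∈ Gal(L/K)`, which form a basis of `A` as a left `L`-vector space and satisfy
`u_σ x = σ(x) u_σ` for `x ∈ L` and `u_σ u_τ = t(σ, τ) u_{στ}`. -/
def IsCrossedProduct (K L A : Type*) [Field K] [Field L] [Algebra K L] [FiniteDimensional K L]
    [Ring A] [Algebra K A] (t : (L ≃ₐ[K] L) × (L ≃ₐ[K] L) → Lˣ) : Prop :=
  IsGalois K L ∧ groupCohomology.IsMulCocycle₂ t ∧
    ∃ (ι : L →ₐ[K] A) (u : (L ≃ₐ[K] L) → Aˣ),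
      Function.Bijective (fun c : (L ≃ₐ[K] L) → L => ∑ σ, ι (c σ) * (u σ : A)) ∧
      (∀ σ x, (u σ : A) * ι x = ι (σ x) * (u σ : A)) ∧
      (∀ σ τ, (u σ : A) * (u τ : A) = ι (t (σ, τ) : L) * (u (σ * τ) : A))

/-- `A` is radical over `k`: it is a crossed product `(L/K, α)` where `L/k` is radical and `α` is
represented by a 2-cocycle with values in `Rad_k(L)`. As `L` embeds into `A`, it is no restriction
to take `L` in the universe of `A`. -/
def IsRadicalOver (k : Type u) (K : Type v) (A : Type w) [Field k] [Field K] [Algebra k K]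
    [Ring A] [Algebra K A] : Prop :=
  ∃ (L : Type w) (_ : Field L) (_ : Algebra K L) (_ : Algebra k L) (_ : IsScalarTower k K L)
    (_ : FiniteDimensional K L) (t : (L ≃ₐ[K] L) × (L ≃ₐ[K] L) → Lˣ),
    IsRadicalExtension k L ∧ (∀ p, t p ∈ radGroup k L) ∧ IsCrossedProduct K L A t

/-- `A` is radical abelian over `k`: as before, with `L/K` an abelian extension. -/
def IsRadicalAbelianOver (k : Type u) (K : Type v) (A : Type w) [Field k] [Field K] [Algebra k K]
    [Ring A] [Algebra K A] : Prop :=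
  ∃ (L : Type w) (_ : Field L) (_ : Algebra K L) (_ : Algebra k L) (_ : IsScalarTower k K L)
    (_ : FiniteDimensional K L) (t : (L ≃ₐ[K] L) × (L ≃ₐ[K] L) → Lˣ),
    IsRadicalExtension k L ∧ (∀ p, t p ∈ radGroup k L) ∧ IsCrossedProduct K L A t ∧
      ∀ σ τ : L ≃ₐ[K] L, σ * τ = τ * σ

/-! For (a), choose a finite set `S` of radicals which spans `L` over `k` and contains the values
of the cocycle. The Galois group moves the members of `S` only by factors in a finite group of
roots of unity, which is cyclic, say `⟨ζ⟩`. The subgroup of `Gal(L/K)` fixing `ζ` then acts through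
Kummer characters, its elements being sent to powers of themselves by conjugation, so that
`Gal(L/K)` is supersolvable; and the group generated by `ζ`, `S` and the `u σ`, an extension of
`Gal(L/K)` by the group generated by `ζ` and `S`, is supersolvable for the same reason.

For (b), suppose first that an abelian normal subgroup of `Γ` generates over `K` a commutative
algebra which is not a field. Simplicity of `A` makes this algebra reduced, and the `Γ`-conjugates
of one of its minimal idempotents `e` are orthogonal with sum `1`. Hence `A` is a matrix algebra
over `e A e`, which is generated by the image of the stabilizer of `e`, and one concludes by
induction on the dimension. Otherwise, finite abelian normal subgroups of `Γ` embed in fields, so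
they are cyclic and centralized by the commutator subgroup, which is finite by Schur's theorem.
Since `Γ` is supersolvable, an abelian normal subgroup of `Γ` that is maximal inside the commutator
subgroup contains its own centralizer there, so it is the whole commutator subgroup. The latter is
thus abelian, and lies in a self-centralizing abelian normal subgroup `N` of `Γ`. The field `L`
generated by `N` satisfies `A = ⨁ L u σ`, and `Gal(L/K)` is a quotient of `Γ / N`, hence abelian.
-/

open scoped commutatorElement

section Supersolvable

variable {G G' : Type*} [Group G] [Group G']

theorem isCyclic_quotient_subgroupOf_iff {N M : Subgroup G} [N.Normal] (hNM : N ≤ M) :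
    IsCyclic (M ⧸ N.subgroupOf M) ↔ ∃ g, M = N ⊔ Subgroup.zpowers g := by
  rw [isCyclic_iff_exists_zpowers_eq_top, (QuotientGroup.mk'_surjective _).exists]
  have key (g : M) : Subgroup.zpowers (QuotientGroup.mk' (N.subgroupOf M) g) = ⊤ ↔
      M = N ⊔ Subgroup.zpowers (g : G) := by
    rw [← MonoidHom.map_zpowers,
      ← (Subgroup.comap_injective (QuotientGroup.mk'_surjective _)).eq_iff,
      Subgroup.comap_map_eq, QuotientGroup.ker_mk', Subgroup.comap_top,
      ← (Subgroup.map_injective M.subtype_injective).eq_iff, Subgroup.map_sup,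
      Subgroup.map_subgroupOf_eq_of_le hNM, MonoidHom.map_zpowers, ← MonoidHom.range_eq_map,
      Subgroup.range_subtype, sup_comm, eq_comm, Subgroup.subtype_apply]
  simp only [key, Subtype.exists, exists_prop]
  exact exists_congr fun g => and_iff_right_of_imp fun h =>
    h.ge (Subgroup.mem_sup_right (Subgroup.mem_zpowers g))

theorem exists_comap_eq_ker_sup_zpowers (f : G' →* G) (C : Subgroup G) [IsCyclic C] :
    ∃ h, C.comap f = f.ker ⊔ Subgroup.zpowers h := by
  have : IsCyclic ((C.comap f).map f) := Subgroup.isCyclic_of_le (Subgroup.map_comap_le f C)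
  obtain ⟨_, hgen⟩ := Subgroup.isCyclic_iff_exists_zpowers_eq_top _ |>.1 this
  obtain ⟨h, -, rfl⟩ : _ ∈ (C.comap f).map f := hgen ▸ Subgroup.mem_zpowers _
  refine ⟨h, ?_⟩
  rw [← sup_eq_left.2 (Subgroup.ker_le_comap f C), ← Subgroup.comap_map_eq, ← hgen,
    ← MonoidHom.map_zpowers, Subgroup.comap_map_eq, sup_comm]

theorem exists_comap_sup_zpowers_eq (f : G' →* G) (N : Subgroup G) [N.Normal] (g : G) :
    ∃ h, (N ⊔ Subgroup.zpowers g).comap f = N.comap f ⊔ Subgroup.zpowers h := by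
  obtain ⟨h, hh⟩ := exists_comap_eq_ker_sup_zpowers ((QuotientGroup.mk' N).comp f)
    (Subgroup.zpowers (QuotientGroup.mk' N g))
  refine ⟨h, ?_⟩
  rwa [← Subgroup.comap_comap, ← MonoidHom.map_zpowers, Subgroup.comap_map_eq,
    QuotientGroup.ker_mk', ← MonoidHom.comap_ker, QuotientGroup.ker_mk', sup_comm] at hh

theorem normal_sup_zpowers {N : Subgroup G} [hN : N.Normal] {g : G}
    (hg : ∀ γ, γ * g * γ⁻¹ ∈ N ⊔ Subgroup.zpowers g) : (N ⊔ Subgroup.zpowers g).Normal := by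
  refine ⟨fun x hx γ => ?_⟩
  suffices N ⊔ Subgroup.zpowers g ≤
      (N ⊔ Subgroup.zpowers g).comap (MulAut.conj γ).toMonoidHom from this hx
  exact sup_le (fun y hy => Subgroup.mem_sup_left (hN.conj_mem y hy γ))
    (Subgroup.zpowers_le.2 (hg γ))

/-- A subgroup is supersolvably embedded in `G` if it is the last term of a finite series starting
at `⊥` of subgroups which are normal in `G`, with cyclic quotients. Each step is encoded by a
generator of the quotient. -/
inductive SupersolvablyEmbedded : Subgroup G → Prop
  | bot : SupersolvablyEmbedded ⊥
  | sup_zpowers {N : Subgroup G} (hN : SupersolvablyEmbedded N) (g : G)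
      (h : (N ⊔ Subgroup.zpowers g).Normal) : SupersolvablyEmbedded (N ⊔ Subgroup.zpowers g)

namespace SupersolvablyEmbedded

theorem normal {N : Subgroup G} (hN : SupersolvablyEmbedded N) : N.Normal := by
  cases hN with
  | bot => infer_instance
  | sup_zpowers _ _ h => exact h

theorem comap {N : Subgroup G} (hN : SupersolvablyEmbedded N) (f : G' →* G)
    (hf : SupersolvablyEmbedded f.ker) : SupersolvablyEmbedded (N.comap f) := by
  induction hN with
  | bot => rwa [MonoidHom.comap_bot]
  | @sup_zpowers N hN g h ih =>
    have := hN.normal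
    obtain ⟨g', hg'⟩ := exists_comap_sup_zpowers_eq f N g
    rw [hg']
    exact ih.sup_zpowers g' (hg' ▸ h.comap f)

theorem map {N : Subgroup G} (hN : SupersolvablyEmbedded N) {f : G →* G'}
    (hf : Function.Surjective f) : SupersolvablyEmbedded (N.map f) := by
  induction hN with
  | bot => rw [Subgroup.map_bot]; exact bot
  | sup_zpowers _ g h ih =>
    have := h.map f hf
    rw [Subgroup.map_sup, MonoidHom.map_zpowers] at this ⊢
    exact ih.sup_zpowers _ this

theorem sup_closure {N : Subgroup G} (hN : SupersolvablyEmbedded N) {T : Set G} (hT : T.Finite)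
    (h : ∀ g ∈ T, ∀ γ : G, γ * g * γ⁻¹ ∈ N ⊔ Subgroup.zpowers g) :
    SupersolvablyEmbedded (N ⊔ Subgroup.closure T) := by
  induction T, hT using Set.Finite.induction_on with
  | empty => simpa only [Subgroup.closure_empty, sup_bot_eq] using hN
  | @insert g T _ _ ih =>
    have hNT := ih fun g' hg' => h g' (Set.mem_insert_of_mem _ hg')
    have := hNT.normal
    rw [Set.insert_eq, Set.union_comm, Subgroup.closure_union, ← Subgroup.zpowers_eq_closure,
      ← sup_assoc]
    have hle : N ⊔ Subgroup.zpowers g ≤ N ⊔ Subgroup.closure T ⊔ Subgroup.zpowers g :=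
      sup_le_sup_right le_sup_left _
    exact hNT.sup_zpowers g (normal_sup_zpowers fun γ => hle (h g (Set.mem_insert _ _) γ))

theorem exists_series {M : Subgroup G} (hM : SupersolvablyEmbedded M) :
    ∃ (n : ℕ) (N : ℕ → Subgroup G), (∀ i, (N i).Normal) ∧ N 0 = ⊥ ∧ N n = M ∧
      ∀ i < n, ∃ g, N (i + 1) = N i ⊔ Subgroup.zpowers g := by
  induction hM with
  | bot => exact ⟨0, fun _ => ⊥, fun _ => inferInstance, rfl, rfl, fun i hi => by omega⟩
  | sup_zpowers hN g h ih =>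
    obtain ⟨n, S, hS, h0, rfl, hc⟩ := ih
    refine ⟨n + 1, fun i => if i ≤ n then S i else S n ⊔ Subgroup.zpowers g, fun i => ?_, ?_,
      if_neg n.not_succ_le_self, fun i hi => ?_⟩
    · dsimp only
      split_ifs
      exacts [hS i, h]
    · exact (if_pos n.zero_le).trans h0
    · rcases (Nat.lt_succ_iff.1 hi).lt_or_eq with hi' | rfl
      · obtain ⟨g', hg'⟩ := hc i hi'
        exact ⟨g', by simp only [if_pos hi'.le, if_pos (Nat.succ_le_of_lt hi'), hg']⟩
      · exact ⟨g, by simp only [le_refl, if_true, if_neg i.not_succ_le_self]⟩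

end SupersolvablyEmbedded

theorem isSupersolvable_iff : IsSupersolvable G ↔ SupersolvablyEmbedded (⊤ : Subgroup G) := by
  constructor
  · rintro ⟨n, N, hN, h0, hn, h⟩
    suffices ∀ i ≤ n, SupersolvablyEmbedded (N i) from hn ▸ this n le_rfl
    intro i hi
    induction i with
    | zero => rw [h0]; exact .bot
    | succ i ih =>
      obtain ⟨hle, hcyc⟩ := h i hi
      obtain ⟨g, hg⟩ := (isCyclic_quotient_subgroupOf_iff hle).1 hcyc
      have := hN (i + 1)
      rw [hg] at this ⊢
      exact (ih (by omega)).sup_zpowers g this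
  · intro h
    obtain ⟨n, N, hN, h0, hn, hstep⟩ := h.exists_series
    have hle (i) (hi : i < n) : N i ≤ N (i + 1) := by
      obtain ⟨g, hg⟩ := hstep i hi
      exact hg ▸ le_sup_left
    exact ⟨n, N, hN, h0, hn, fun i hi =>
      ⟨hle i hi, (isCyclic_quotient_subgroupOf_iff (hle i hi)).2 (hstep i hi)⟩⟩

namespace IsSupersolvable

theorem of_ker (hG : IsSupersolvable G) (f : G' →* G) (hf : SupersolvablyEmbedded f.ker) :
    IsSupersolvable G' :=
  isSupersolvable_iff.2 ((isSupersolvable_iff.1 hG).comap f hf)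

theorem of_injective (hG : IsSupersolvable G) {f : G' →* G} (hf : Function.Injective f) :
    IsSupersolvable G' :=
  hG.of_ker f ((f.ker_eq_bot_iff.2 hf).symm ▸ .bot)

theorem of_surjective (hG : IsSupersolvable G) {f : G →* G'} (hf : Function.Surjective f) :
    IsSupersolvable G' := by
  rw [isSupersolvable_iff, ← Subgroup.map_top_of_surjective f hf]
  exact (isSupersolvable_iff.1 hG).map hf

open Subgroup in
theorem exists_selfCentralizing (hG : IsSupersolvable G) {D N₀ : Subgroup G} [D.Normal]
    [N₀.Normal] [IsMulCommutative N₀] (hN₀ : N₀ ≤ D) :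
    ∃ N : Subgroup G, N.Normal ∧ IsMulCommutative N ∧ N₀ ≤ N ∧ N ≤ D ∧
      centralizer (N : Set G) ⊓ D ≤ N := by
  suffices ∀ M, SupersolvablyEmbedded M → ∃ N : Subgroup G, N.Normal ∧ IsMulCommutative N ∧
      N₀ ≤ N ∧ N ≤ D ∧ centralizer (N : Set G) ⊓ D ⊓ M ≤ N by
    simpa only [inf_top_eq] using this ⊤ (isSupersolvable_iff.1 hG)
  intro M hM
  induction hM with
  | bot => exact ⟨N₀, inferInstance, inferInstance, le_rfl, hN₀, by simp only [inf_bot_eq, bot_le]⟩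
  | @sup_zpowers S hS g h ih =>
    obtain ⟨N, hN, hNcomm, hN₀N, hND, hNS⟩ := ih
    have := hS.normal
    set C := centralizer (N : Set G) ⊓ D
    obtain ⟨c, hcC, hc⟩ : ∃ c ∈ C, C ⊓ (S ⊔ zpowers g) = (C ⊓ S) ⊔ zpowers c := by
      obtain ⟨c, hc⟩ := exists_comap_sup_zpowers_eq C.subtype S g
      refine ⟨c, c.2, ?_⟩
      simpa only [map_comap_eq, Subgroup.map_sup, MonoidHom.map_zpowers, range_subtype,
        subtype_apply] using congrArg (Subgroup.map C.subtype) hc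
    have hNc : N ⊔ C ⊓ (S ⊔ zpowers g) = N ⊔ zpowers c := by
      rw [hc, ← sup_assoc, sup_eq_left.2 hNS]
    refine ⟨N ⊔ C ⊓ (S ⊔ zpowers g), inferInstance, ?_, hN₀N.trans le_sup_left,
      sup_le hND (inf_le_left.trans inf_le_right), ?_⟩
    · have hNN : N ≤ centralizer N := le_centralizer_iff_isMulCommutative.2 hNcomm
      have hcN : zpowers c ≤ centralizer N := zpowers_le.2 hcC.1
      rw [hNc, ← le_centralizer_iff_isMulCommutative]
      exact sup_le (le_centralizer_iff.1 (sup_le hNN hcN))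
        (le_centralizer_iff.1 (sup_le (le_centralizer_iff.1 hcN) (le_centralizer _)))
    · exact (inf_le_inf_right _ (inf_le_inf_right _ (centralizer_le
        (SetLike.coe_subset_coe.2 le_sup_left)))).trans le_sup_right

end IsSupersolvable

theorem finite_commutator_of_finiteIndex_le_center {Z : Subgroup G} (hZ : Z ≤ Subgroup.center G)
    [Z.FiniteIndex] : Finite (commutator G) := by
  have commutator_mul {a b z z' : G} (hz : z ∈ Z) (hz' : z' ∈ Z) :
      ⁅a * z, b * z'⁆ = ⁅a, b⁆ := by
    have hc {c} (hc : c ∈ Z) (g : G) : g * c = c * g := Subgroup.mem_center_iff.1 (hZ hc) g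
    calc ⁅a * z, b * z'⁆ = a * (z * (b * z')) * z⁻¹ * a⁻¹ * z'⁻¹ * b⁻¹ := by group
      _ = a * b * (z' * a⁻¹) * z'⁻¹ * b⁻¹ := by rw [← hc hz]; group
      _ = ⁅a, b⁆ := by rw [← hc hz']; group
  have : commutatorSet G ⊆ Set.range fun p : (G ⧸ Z) × (G ⧸ Z) => ⁅p.1.out, p.2.out⁆ := by
    rintro _ ⟨a, b, rfl⟩
    obtain ⟨⟨z, hz⟩, ha⟩ := QuotientGroup.mk_out_eq_mul Z a
    obtain ⟨⟨z', hz'⟩, hb⟩ := QuotientGroup.mk_out_eq_mul Z b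
    exact ⟨(a, b), by simp only [ha, hb, commutator_mul hz hz']⟩
  have : Finite (commutatorSet G) := (Set.finite_range _).subset this
  infer_instance

-- The point is that the automorphism group of the cyclic group `⟨ζ⟩` is abelian.
theorem apply_eq_self_of_mem_commutator {M : Type*} [Group M] (φ : G →* MulAut M) {ζ : M}
    (hζ : ∀ g, φ g ζ ∈ Subgroup.zpowers ζ) {g : G} (hg : g ∈ commutator G) : φ g ζ = ζ := by
  have hcomm (a b : G) : φ (a * b) ζ = φ (b * a) ζ := by
    obtain ⟨m, hm⟩ := Subgroup.mem_zpowers_iff.1 (hζ a)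
    obtain ⟨n, hn⟩ := Subgroup.mem_zpowers_iff.1 (hζ b)
    simp only [map_mul, MulAut.mul_apply, ← hm, ← hn, map_zpow, ← zpow_mul, mul_comm]
  suffices commutator G ≤ (MulAction.stabilizer (MulAut M) ζ).comap φ from this hg
  rw [commutator_def, Subgroup.commutator_le]
  intro a _ b _
  change φ ⁅a, b⁆ ζ = ζ
  rw [show ⁅a, b⁆ = a * b * (b * a)⁻¹ by group, hcomm, map_mul, MulAut.mul_apply, hcomm a b,
    ← MulAut.mul_apply, ← map_mul, inv_mul_cancel, map_one, MulAut.one_apply]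

theorem commutator_le_centralizer_of_isCyclic (N : Subgroup G) [N.Normal] [IsCyclic N] :
    commutator G ≤ Subgroup.centralizer N := by
  obtain ⟨n, hn⟩ := IsCyclic.exists_generator (α := N)
  intro g hg y hy
  obtain ⟨m, hm⟩ := hn ⟨y, hy⟩
  have hgn : MulAut.conjNormal g n = n := apply_eq_self_of_mem_commutator _ (fun _ => hn _) hg
  have hgy : MulAut.conjNormal g (⟨y, hy⟩ : N) = ⟨y, hy⟩ := by
    rw [← hm, map_zpow, hgn]
  exact (mul_inv_eq_iff_eq_mul.1 (congrArg Subtype.val hgy)).symm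

end Supersolvable

section SemidirectExtension

variable {X Q : Type*} [Group X] [Group Q]

/-- The group `⋃ σ, N * u σ`, where `N` is a subgroup and `u` is multiplicative modulo `N` with
values in the normalizer of `N`. -/
def crossedSubgroup (N : Subgroup X) (u : Q → X) (hconj : ∀ σ, ∀ n ∈ N, u σ * n * (u σ)⁻¹ ∈ N)
    (hmul : ∀ σ τ, u σ * u τ * (u (σ * τ))⁻¹ ∈ N) : Subgroup X where
  carrier := {x | ∃ σ, x * (u σ)⁻¹ ∈ N}
  mul_mem' := by
    rintro x y ⟨σ, hx⟩ ⟨τ, hy⟩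
    refine ⟨σ * τ, ?_⟩
    convert mul_mem (mul_mem hx (hconj σ _ hy)) (hmul σ τ) using 1
    group
  one_mem' := ⟨1, by simpa using hmul 1 1⟩
  inv_mem' := by
    rintro x ⟨σ, hx⟩
    have hu : u σ⁻¹ * u σ ∈ N := by simpa using mul_mem (hmul σ⁻¹ σ) (hmul 1 1)
    refine ⟨σ⁻¹, ?_⟩
    convert inv_mem (mul_mem (hconj σ⁻¹ _ hx) hu) using 1
    group

variable {N : Subgroup X} {u : Q → X} {hconj : ∀ σ, ∀ n ∈ N, u σ * n * (u σ)⁻¹ ∈ N}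
  {hmul : ∀ σ τ, u σ * u τ * (u (σ * τ))⁻¹ ∈ N}

theorem apply_one_mem (hmul : ∀ σ τ, u σ * u τ * (u (σ * τ))⁻¹ ∈ N) : u 1 ∈ N := by
  simpa using hmul 1 1

theorem le_crossedSubgroup : N ≤ crossedSubgroup N u hconj hmul := fun _ hn =>
  ⟨1, mul_mem hn (inv_mem (apply_one_mem hmul))⟩

theorem apply_mem_crossedSubgroup (σ : Q) : u σ ∈ crossedSubgroup N u hconj hmul :=
  ⟨σ, by rw [mul_inv_cancel]; exact one_mem N⟩

end SemidirectExtension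

section KummerSystem

variable {G M : Type*} [Group G] [CommGroup M] [MulDistribMulAction G M]

theorem smul_mem_closure {T : Set M} {g : G} (hT : ∀ x ∈ T, g • x ∈ Subgroup.closure T) {x : M}
    (hx : x ∈ Subgroup.closure T) : g • x ∈ Subgroup.closure T := by
  suffices Subgroup.closure T ≤
    (Subgroup.closure T).comap (MulDistribMulAction.toMonoidHom M g) from this hx
  exact (Subgroup.closure_le _).2 hT

theorem smul_eq_self_of_mem_commutator {ζ : M} (hζ : ∀ g : G, g • ζ ∈ Subgroup.zpowers ζ) {g : G}
    (hg : g ∈ commutator G) : g • ζ = ζ :=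
  apply_eq_self_of_mem_commutator (MulDistribMulAction.toMulAut G M) hζ hg

variable (G) in
/-- A Kummer system for the action of `G` on `M` is a set `S` all of whose members are changed by
`G` only through powers of a single member `ζ`; the model is a set of radicals together with a root
of unity of sufficiently high order. -/
structure IsKummerSystem (ζ : M) (S : Set M) : Prop where
  root_mem : ζ ∈ S
  smul_div_mem (g : G) {s : M} (hs : s ∈ S) : g • s / s ∈ Subgroup.zpowers ζ

namespace IsKummerSystem

variable {ζ : M} {S : Set M}

theorem smul_root_mem (h : IsKummerSystem G ζ S) (g : G) : g • ζ ∈ Subgroup.zpowers ζ := by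
  simpa using mul_mem (h.smul_div_mem g h.root_mem) (Subgroup.mem_zpowers ζ)

theorem smul_mem_closure (h : IsKummerSystem G ζ S) (g : G) {m : M}
    (hm : m ∈ Subgroup.closure S) : g • m ∈ Subgroup.closure S := by
  refine _root_.smul_mem_closure (fun s hs => ?_) hm
  have hle : Subgroup.zpowers ζ ≤ Subgroup.closure S :=
    Subgroup.zpowers_le.2 (Subgroup.subset_closure h.root_mem)
  simpa using mul_mem (hle (h.smul_div_mem g hs)) (Subgroup.subset_closure hs)

theorem smul_eq_zpow {g : G} {j : ℤ} (hg : g • ζ = ζ ^ j) {z : M}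
    (hz : z ∈ Subgroup.zpowers ζ) : g • z = z ^ j := by
  obtain ⟨m, rfl⟩ := Subgroup.mem_zpowers_iff.1 hz
  rw [smul_zpow', hg, zpow_comm]

theorem smul_eq_self {g : G} (hg : g • ζ = ζ) {z : M} (hz : z ∈ Subgroup.zpowers ζ) :
    g • z = z := by
  simpa using smul_eq_zpow (j := 1) (by simpa using hg) hz

/-- The Kummer character `σ ↦ σ • s / s` on the stabilizer of `ζ`. -/
def character (h : IsKummerSystem G ζ S) {s : M} (hs : s ∈ S) :
    MulAction.stabilizer G ζ →* M :=
  MonoidHom.mk' (fun σ => (σ : G) • s / s) fun σ τ => by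
    have hτ : (σ : G) • ((τ : G) • s / s) = (τ : G) • s / s :=
      smul_eq_self σ.2 (h.smul_div_mem τ hs)
    have hστ : (σ : G) • (τ : G) • s = ((τ : G) • s / s) * (σ : G) • s := by
      rw [← hτ, ← smul_mul', div_mul_cancel]
    rw [Subgroup.coe_mul, mul_smul, hστ, mul_div_assoc, mul_comm]

theorem zpow_smul (h : IsKummerSystem G ζ S) {s : M} (hs : s ∈ S) {σ : G} (hσ : σ • ζ = ζ)
    (j : ℤ) : σ ^ j • s = (σ • s / s) ^ j * s := by
  have := map_zpow (h.character hs) ⟨σ, hσ⟩ j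
  exact div_eq_iff_eq_mul.1 this

theorem conj_smul (h : IsKummerSystem G ζ S) {s : M} (hs : s ∈ S) {σ τ : G} (hσ : σ • ζ = ζ)
    {j : ℤ} (hτ : τ • ζ = ζ ^ j) : (τ * σ * τ⁻¹) • s = σ ^ j • s := by
  have hfix : σ • (τ⁻¹ • s / s) = τ⁻¹ • s / s := smul_eq_self hσ (h.smul_div_mem τ⁻¹ hs)
  have hσs : σ • τ⁻¹ • s = (σ • s / s) * τ⁻¹ • s := by
    conv_lhs => rw [← div_mul_cancel (τ⁻¹ • s) s, smul_mul', hfix]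
    rw [div_mul_eq_mul_div, div_mul_eq_mul_div, mul_comm]
  rw [h.zpow_smul hs hσ, ← smul_eq_zpow hτ (h.smul_div_mem σ hs), mul_smul, mul_smul, hσs,
    smul_mul', smul_inv_smul]

theorem isSupersolvable [Finite G] (h : IsKummerSystem G ζ S)
    (hS : ∀ g : G, (∀ s ∈ S, g • s = s) → g = 1) : IsSupersolvable G := by
  have conj_eq {σ τ : G} (hσ : σ • ζ = ζ) {j : ℤ} (hτ : τ • ζ = ζ ^ j) :
      τ * σ * τ⁻¹ = σ ^ j := by
    rw [← inv_mul_eq_one]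
    refine hS _ fun s hs => ?_
    rw [mul_smul, ← h.conj_smul hs hσ hτ, inv_smul_smul]
  have hstab : SupersolvablyEmbedded (MulAction.stabilizer G ζ) := by
    have := SupersolvablyEmbedded.bot.sup_closure
      (Set.toFinite (MulAction.stabilizer G ζ : Set G)) fun σ hσ τ => by
        obtain ⟨j, hj⟩ := Subgroup.mem_zpowers_iff.1 (h.smul_root_mem τ)
        rw [conj_eq hσ hj.symm]
        exact Subgroup.mem_sup_right (Subgroup.zpow_mem_zpowers σ j)
    rwa [Subgroup.closure_eq, bot_sup_eq] at this
  have htop := hstab.sup_closure Set.finite_univ fun σ _ τ => by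
    have hcomm : ⁅τ, σ⁆ ∈ commutator G :=
      Subgroup.commutator_mem_commutator (Subgroup.mem_top τ) (Subgroup.mem_top σ)
    have hfix : ⁅τ, σ⁆ ∈ MulAction.stabilizer G ζ :=
      smul_eq_self_of_mem_commutator h.smul_root_mem hcomm
    have := mul_mem (Subgroup.mem_sup_left hfix)
      (Subgroup.mem_sup_right (Subgroup.mem_zpowers σ))
    rwa [commutatorElement_def, inv_mul_cancel_right] at this
  rwa [Subgroup.closure_univ, sup_top_eq, ← isSupersolvable_iff] at htop

end IsKummerSystem

theorem SupersolvablyEmbedded.closure {G : Type*} [Group G] {T : Set G} (hT : T.Finite) {z : G}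
    (hz : z ∈ T) (h : ∀ g ∈ T, ∀ γ : G, γ * g * γ⁻¹ * g⁻¹ ∈ Subgroup.zpowers z) :
    SupersolvablyEmbedded (Subgroup.closure T) := by
  have conj_mem {g} (hg : g ∈ T) (γ : G) :
      γ * g * γ⁻¹ ∈ Subgroup.zpowers z ⊔ Subgroup.zpowers g := by
    simpa using mul_mem (Subgroup.mem_sup_left (h g hg γ))
      (Subgroup.mem_sup_right (Subgroup.mem_zpowers g) : g ∈ Subgroup.zpowers z ⊔ _)
  have hz' : SupersolvablyEmbedded (Subgroup.zpowers z) := by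
    have := bot.sup_zpowers z (normal_sup_zpowers fun γ => by simpa using conj_mem hz γ)
    rwa [bot_sup_eq] at this
  have := hz'.sup_closure hT fun g hg => conj_mem hg
  rwa [sup_eq_right.2 (Subgroup.zpowers_le.2 (Subgroup.subset_closure hz))] at this

theorem finite_closure_of_isOfFinOrder {S : Set M} (hS : S.Finite)
    (hfin : ∀ s ∈ S, IsOfFinOrder s) : Finite (Subgroup.closure S) := by
  have := hS.to_subtype
  have : Group.FG (Subgroup.closure S) := Group.closure_finite_fg S
  have hle : Subgroup.closure S ≤ CommGroup.torsion M := (Subgroup.closure_le _).2 hfin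
  exact CommGroup.finite_of_fg_isMulTorsion _ fun x => Submonoid.isOfFinOrder_coe.1 (hle x.2)

theorem relIndex_closure_ne_zero {Z : Subgroup M} {S : Set M} (hS : S.Finite)
    (hpow : ∀ s ∈ S, ∃ n : ℕ, 0 < n ∧ s ^ n ∈ Z) : Z.relIndex (Subgroup.closure S) ≠ 0 := by
  rw [← QuotientGroup.ker_mk' Z, Subgroup.relIndex_ker, MonoidHom.map_closure]
  have := finite_closure_of_isOfFinOrder (hS.image (QuotientGroup.mk' Z)) <| by
    rintro _ ⟨s, hs, rfl⟩
    obtain ⟨n, hn, hsn⟩ := hpow s hs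
    refine isOfFinOrder_iff_pow_eq_one.2 ⟨n, hn, ?_⟩
    rwa [← map_pow, QuotientGroup.mk'_apply, QuotientGroup.eq_one_iff]
  exact Nat.card_pos.ne'

end KummerSystem

section Radical

variable {k K L : Type*} [Field k] [Field K] [Field L] [Algebra k K] [Algebra K L] [Algebra k L]
  [IsScalarTower k K L]

theorem smul_eq_self_of_mem_scalarUnits {x : Lˣ} (hx : x ∈ scalarUnits k L) (σ : L ≃ₐ[K] L) :
    σ • x = x := by
  obtain ⟨c, rfl⟩ := hx
  ext
  change σ (algebraMap k L c) = algebraMap k L c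
  rw [IsScalarTower.algebraMap_apply k K L, σ.commutes]

theorem isOfFinOrder_smul_div {x : Lˣ} (hx : x ∈ radGroup k L) (σ : L ≃ₐ[K] L) :
    IsOfFinOrder (σ • x / x) := by
  obtain ⟨n, hn, h⟩ := hx
  refine isOfFinOrder_iff_pow_eq_one.2 ⟨n, hn, ?_⟩
  rw [div_pow, ← smul_pow', smul_eq_self_of_mem_scalarUnits h, div_self']

theorem mem_radGroup_of_isOfFinOrder {x : Lˣ} (hx : IsOfFinOrder x) : x ∈ radGroup k L := by
  obtain ⟨n, hn, h⟩ := isOfFinOrder_iff_pow_eq_one.1 hx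
  exact ⟨n, hn, h ▸ one_mem _⟩

theorem exists_isKummerSystem [FiniteDimensional K L] {S : Set Lˣ} (hS : S.Finite)
    (hrad : S ⊆ radGroup k L) :
    ∃ ζ ∈ radGroup k L, IsKummerSystem (L ≃ₐ[K] L) ζ (insert ζ S) := by
  let R : Subgroup Lˣ :=
    Subgroup.closure (Set.image2 (fun (σ : L ≃ₐ[K] L) s => σ • s / s) Set.univ S)
  have smul_div_mem (σ : L ≃ₐ[K] L) {s} (hs : s ∈ S) : σ • s / s ∈ R :=
    Subgroup.subset_closure (Set.mem_image2_of_mem (Set.mem_univ σ) hs)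
  have : Finite R := finite_closure_of_isOfFinOrder (Set.finite_univ.image2 _ hS) <| by
    rintro _ ⟨σ, -, s, hs, rfl⟩
    exact isOfFinOrder_smul_div (hrad hs) σ
  have smul_mem (σ : L ≃ₐ[K] L) {x} (hx : x ∈ R) : σ • x ∈ R := by
    refine smul_mem_closure ?_ hx
    rintro _ ⟨τ, -, s, hs, rfl⟩
    have : σ • (τ • s / s) = (σ * τ) • s / s / (σ • s / s) := by
      rw [smul_div', mul_smul, div_div_div_cancel_right]
    exact this ▸ div_mem (smul_div_mem _ hs) (smul_div_mem σ hs)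
  obtain ⟨ζ, hζ⟩ := Subgroup.isCyclic_iff_exists_zpowers_eq_top R |>.1 inferInstance
  have hζR : ζ ∈ R := hζ ▸ Subgroup.mem_zpowers ζ
  refine ⟨ζ, mem_radGroup_of_isOfFinOrder
    (Submonoid.isOfFinOrder_coe.2 (isOfFinOrder_of_finite (⟨ζ, hζR⟩ : R))),
    Set.mem_insert ζ S, fun σ s hs => hζ ▸ ?_⟩
  rcases hs with rfl | hs
  exacts [div_mem (smul_mem σ hζR) hζR, smul_div_mem σ hs]

theorem span_units_eq_top {R A : Type*} [CommSemiring R] [Ring A] [Algebra R A] {Γ : Subgroup Aˣ}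
    (h : Algebra.adjoin R (Units.val '' (Γ : Set Aˣ)) = ⊤) :
    Submodule.span R (Units.val '' (Γ : Set Aˣ)) = ⊤ := by
  have hclosure : (Submonoid.closure (Units.val '' (Γ : Set Aˣ)) : Set A) = Units.val '' Γ :=
    congrArg SetLike.coe (Submonoid.closure_eq (Γ.toSubmonoid.map (Units.coeHom A)))
  rw [← Algebra.top_toSubmodule, ← h, Algebra.adjoin_eq_span, hclosure]

theorem IsRadicalExtension.exists_finite_span_eq_top [FiniteDimensional k L]
    (h : IsRadicalExtension k L) :
    ∃ S ⊆ (radGroup k L : Set Lˣ), S.Finite ∧ Submodule.span k (Units.val '' S) = ⊤ := by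
  set R : Set L := Units.val '' (radGroup k L : Set Lˣ)
  have hadj : Algebra.adjoin k R = ⊤ := by
    rw [← IntermediateField.adjoin_toSubalgebra, h, IntermediateField.top_toSubalgebra]
  have hspan : Submodule.span k R = ⊤ := span_units_eq_top hadj
  obtain ⟨s, hs, hs'⟩ := (Submodule.fg_span_iff_fg_span_finset_subset R).1
    (hspan ▸ Module.Finite.fg_top)
  exact Set.exists_subset_image_finite_and (p := fun t => Submodule.span k t = ⊤).1
    ⟨s, hs, s.finite_toSet, hs'.symm.trans hspan⟩

theorem eq_one_of_smul_eq_self {S : Set Lˣ} (hS : Submodule.span k (Units.val '' S) = ⊤)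
    {σ : L ≃ₐ[K] L} (hσ : ∀ s ∈ S, σ • s = s) : σ = 1 := by
  have : σ.toLinearMap.restrictScalars k = LinearMap.id := by
    refine LinearMap.ext_on hS ?_
    rintro _ ⟨s, hs, rfl⟩
    exact congrArg Units.val (hσ s hs)
  exact AlgEquiv.ext (LinearMap.congr_fun this)

end Radical

section Induces

variable {K L A : Type*} [Field K] [Field L] [Algebra K L] [Ring A] [Algebra K A]
  {ι : L →ₐ[K] A}

/-- The unit `x` of `A` induces the automorphism `σ` of `L` by conjugation. -/
def Induces (ι : L →ₐ[K] A) (x : Aˣ) (σ : L ≃ₐ[K] L) : Prop :=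
  ∀ l : L, SemiconjBy (x : A) (ι l) (ι (σ l))

theorem Induces.mul {x y : Aˣ} {σ τ : L ≃ₐ[K] L} (hx : Induces ι x σ) (hy : Induces ι y τ) :
    Induces ι (x * y) (σ * τ) := fun l => (hx (τ l)).mul_left (hy l)

theorem Induces.inv {x : Aˣ} {σ : L ≃ₐ[K] L} (hx : Induces ι x σ) : Induces ι x⁻¹ σ⁻¹ := fun l => by
  have := hx (σ⁻¹ l)
  rw [← AlgEquiv.mul_apply, mul_inv_cancel] at this
  exact this.units_inv_symm_left

theorem Induces.unique [Nontrivial A] {x : Aˣ} {σ τ : L ≃ₐ[K] L} (hσ : Induces ι x σ)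
    (hτ : Induces ι x τ) : σ = τ :=
  AlgEquiv.ext fun l => ι.injective (x.isUnit.mul_right_cancel ((hσ l).symm.trans (hτ l)))

theorem induces_one : Induces ι 1 1 := fun _ => SemiconjBy.one_left _

theorem induces_map (m : Lˣ) : Induces ι (Units.map (ι : L →* A) m) 1 := fun l =>
  (Commute.all (m : L) l).map ι

theorem Induces.conj_map {x : Aˣ} {σ : L ≃ₐ[K] L} (hx : Induces ι x σ) (m : Lˣ) :
    x * Units.map (ι : L →* A) m * x⁻¹ = Units.map (ι : L →* A) (σ • m) :=
  mul_inv_eq_iff_eq_mul.2 (Units.ext (hx m))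

/-- The units of `A` which induce some automorphism of `L`. -/
def normalizingUnits (ι : L →ₐ[K] A) : Subgroup Aˣ where
  carrier := {x | ∃ σ, Induces ι x σ}
  mul_mem' := fun ⟨σ, hσ⟩ ⟨τ, hτ⟩ => ⟨σ * τ, hσ.mul hτ⟩
  one_mem' := ⟨1, induces_one⟩
  inv_mem' := fun ⟨σ, hσ⟩ => ⟨σ⁻¹, hσ.inv⟩

variable [Nontrivial A]

/-- The automorphism of `L` induced by a unit in `normalizingUnits ι`. -/
noncomputable def inducedAut (ι : L →ₐ[K] A) : normalizingUnits ι →* (L ≃ₐ[K] L) :=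
  MonoidHom.mk' (fun x => x.2.choose) fun x y =>
    (x * y).2.choose_spec.unique (x.2.choose_spec.mul y.2.choose_spec)

theorem induces_inducedAut (x : normalizingUnits ι) : Induces ι x (inducedAut ι x) :=
  x.2.choose_spec

theorem inducedAut_eq {x : normalizingUnits ι} {σ : L ≃ₐ[K] L} (h : Induces ι x σ) :
    inducedAut ι x = σ :=
  (induces_inducedAut x).unique h

end Induces

section CrossedProductGroup

variable {k K L A : Type*} [Field k] [Field K] [Field L] [Algebra k K] [Algebra K L] [Algebra k L]
  [IsScalarTower k K L] [Ring A] [Algebra K A]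

theorem map_scalarUnits_le [Algebra k A] [IsScalarTower k K A] (ι : L →ₐ[K] A) :
    (scalarUnits k L).map (Units.map (ι : L →* A)) ≤ scalarUnits k A := by
  rintro _ ⟨_, ⟨c, rfl⟩, rfl⟩
  refine ⟨c, Units.ext ?_⟩
  exact ((ι.restrictScalars k).commutes c).symm

variable {ι : L →ₐ[K] A} {u : (L ≃ₐ[K] L) → Aˣ} {M : Subgroup Lˣ}
  {hconj : ∀ σ, ∀ x ∈ M.map (Units.map (ι : L →* A)),
    u σ * x * (u σ)⁻¹ ∈ M.map (Units.map (ι : L →* A))}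
  {hmul : ∀ σ τ, u σ * u τ * (u (σ * τ))⁻¹ ∈ M.map (Units.map (ι : L →* A))}

theorem crossedSubgroup_le_normalizingUnits (hu : ∀ σ, Induces ι (u σ) σ) :
    crossedSubgroup _ u hconj hmul ≤ normalizingUnits ι := by
  rintro x ⟨σ, m, -, hm⟩
  refine ⟨1 * σ, ?_⟩
  rw [eq_mul_inv_iff_mul_eq] at hm
  exact hm ▸ (induces_map m).mul (hu σ)

theorem adjoin_crossedSubgroup_eq_top [Algebra k A] [IsScalarTower k K A]
    [FiniteDimensional K L] {S : Set Lˣ}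
    (hspan : Submodule.span k (Units.val '' S) = ⊤)
    (hsurj : Function.Surjective fun c : (L ≃ₐ[K] L) → L => ∑ σ, ι (c σ) * (u σ : A))
    {hconj : ∀ σ, ∀ x ∈ (Subgroup.closure S).map (Units.map (ι : L →* A)),
      u σ * x * (u σ)⁻¹ ∈ (Subgroup.closure S).map (Units.map (ι : L →* A))}
    {hmul : ∀ σ τ, u σ * u τ * (u (σ * τ))⁻¹ ∈
      (Subgroup.closure S).map (Units.map (ι : L →* A))} :
    Algebra.adjoin k (Units.val '' (crossedSubgroup _ u hconj hmul : Set Aˣ)) = ⊤ := by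
  set B := Algebra.adjoin k (Units.val '' (crossedSubgroup _ u hconj hmul : Set Aˣ))
  have hι (l) : ι l ∈ B := by
    have hle : Submodule.span k (Units.val '' S) ≤
        (Subalgebra.toSubmodule B).comap (ι.toLinearMap.restrictScalars k) := by
      rw [Submodule.span_le]
      rintro _ ⟨s, hs, rfl⟩
      exact Algebra.subset_adjoin
        ⟨_, le_crossedSubgroup ⟨s, Subgroup.subset_closure hs, rfl⟩, rfl⟩
    exact hle (hspan ▸ Submodule.mem_top)
  refine Algebra.eq_top_iff.2 fun a => ?_
  obtain ⟨c, rfl⟩ := hsurj a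
  exact sum_mem fun σ _ => mul_mem (hι _)
    (Algebra.subset_adjoin ⟨_, apply_mem_crossedSubgroup σ, rfl⟩)

variable [Nontrivial A]

theorem ker_inducedAut_comp_inclusion (hu : ∀ σ, Induces ι (u σ) σ) :
    ((inducedAut ι).comp (Subgroup.inclusion (crossedSubgroup_le_normalizingUnits hu))).ker =
      (M.map (Units.map (ι : L →* A))).subgroupOf (crossedSubgroup _ u hconj hmul) := by
  ext x
  rw [MonoidHom.mem_ker, Subgroup.mem_subgroupOf]
  constructor
  · intro hx
    obtain ⟨σ, m, hm, hxm⟩ := x.2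
    have hxσ : Induces ι (x : Aˣ) (1 * σ) :=
      eq_mul_inv_iff_mul_eq.1 hxm ▸ (induces_map m).mul (hu σ)
    obtain rfl : σ = 1 := by
      rw [← hx, ← one_mul σ]
      exact (inducedAut_eq hxσ).symm
    rw [← inv_mul_cancel_right (x : Aˣ) (u 1), ← hxm]
    exact mul_mem (Subgroup.mem_map_of_mem _ hm) (apply_one_mem hmul)
  · rintro ⟨m, -, hm⟩
    exact inducedAut_eq (show Induces ι (x : Aˣ) 1 from hm ▸ induces_map m)

theorem IsKummerSystem.isSupersolvable_crossedSubgroup [FiniteDimensional K L] {ζ : Lˣ}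
    {S : Set Lˣ} (hS : IsKummerSystem (L ≃ₐ[K] L) ζ S) (hfin : S.Finite)
    (hspan : Submodule.span k (Units.val '' S) = ⊤) (hu : ∀ σ, Induces ι (u σ) σ)
    {hconj : ∀ σ, ∀ x ∈ (Subgroup.closure S).map (Units.map (ι : L →* A)),
      u σ * x * (u σ)⁻¹ ∈ (Subgroup.closure S).map (Units.map (ι : L →* A))}
    {hmul : ∀ σ τ, u σ * u τ * (u (σ * τ))⁻¹ ∈
      (Subgroup.closure S).map (Units.map (ι : L →* A))} :
    IsSupersolvable (crossedSubgroup _ u hconj hmul) := by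
  have hGal : IsSupersolvable (L ≃ₐ[K] L) :=
    hS.isSupersolvable fun _ => eq_one_of_smul_eq_self hspan
  refine hGal.of_ker _ (?_ : SupersolvablyEmbedded (MonoidHom.ker
    ((inducedAut ι).comp (Subgroup.inclusion (crossedSubgroup_le_normalizingUnits hu)))))
  set Γ := crossedSubgroup _ u hconj hmul
  set J := Units.map (ι : L →* A)
  have hJ {s} (hs : s ∈ S) : J s ∈ Γ :=
    le_crossedSubgroup (Subgroup.mem_map_of_mem _ (Subgroup.subset_closure hs))
  have hclosure : ((Subgroup.closure S).map J).subgroupOf Γ =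
      Subgroup.closure (Subtype.val ⁻¹' (J '' S)) := by
    refine Subgroup.map_injective Γ.subtype_injective ?_
    rw [Subgroup.map_subgroupOf_eq_of_le le_crossedSubgroup, MonoidHom.map_closure,
      MonoidHom.map_closure, Subgroup.coe_subtype, Set.image_preimage_eq_of_subset]
    rintro _ ⟨s, hs, rfl⟩
    exact ⟨⟨J s, hJ hs⟩, rfl⟩
  rw [ker_inducedAut_comp_inclusion hu, hclosure]
  refine .closure ((hfin.image J).preimage Subtype.val_injective.injOn)
    (z := ⟨J ζ, hJ hS.root_mem⟩) (Set.mem_image_of_mem J hS.root_mem) ?_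
  rintro ⟨_, _⟩ ⟨s, hs, rfl⟩ γ
  obtain ⟨σ, hσ⟩ := crossedSubgroup_le_normalizingUnits hu γ.2
  obtain ⟨n, hn⟩ := Subgroup.mem_zpowers_iff.1 (hS.smul_div_mem σ hs)
  refine ⟨n, Subtype.ext ?_⟩
  change J ζ ^ n = γ * J s * (γ : Aˣ)⁻¹ * (J s)⁻¹
  rw [hσ.conj_map, ← map_inv, ← map_mul, ← map_zpow, hn, div_eq_mul_inv]

variable [Algebra k A] [IsScalarTower k K A]

theorem relIndex_crossedSubgroup_ne_zero [FiniteDimensional K L] {S : Set Lˣ} (hfin : S.Finite)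
    (hrad : S ⊆ radGroup k L) (hu : ∀ σ, Induces ι (u σ) σ)
    {hconj : ∀ σ, ∀ x ∈ (Subgroup.closure S).map (Units.map (ι : L →* A)),
      u σ * x * (u σ)⁻¹ ∈ (Subgroup.closure S).map (Units.map (ι : L →* A))}
    {hmul : ∀ σ τ, u σ * u τ * (u (σ * τ))⁻¹ ∈
      (Subgroup.closure S).map (Units.map (ι : L →* A))} :
    (scalarUnits k A).relIndex (crossedSubgroup _ u hconj hmul) ≠ 0 := by
  refine Subgroup.relIndex_ne_zero_trans
    (K := (Subgroup.closure S).map (Units.map (ι : L →* A))) ?_ ?_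
  · rw [← Subgroup.relIndex_comap]
    refine relIndex_closure_ne_zero hfin fun s hs => ?_
    obtain ⟨n, hn, hsn⟩ := hrad hs
    exact ⟨n, hn, map_scalarUnits_le ι (Subgroup.mem_map_of_mem _ hsn)⟩
  · rw [Subgroup.relIndex, ← ker_inducedAut_comp_inclusion hu]
    exact (Subgroup.finiteIndex_ker _).index_ne_zero

end CrossedProductGroup

theorem IsRadicalOver.isGeneratedBySupersolvable {k : Type u} {K : Type v} {A : Type w} [Field k]
    [Field K] [Algebra k K] [Ring A] [Nontrivial A] [Algebra K A] [Algebra k A]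
    [IsScalarTower k K A] [FiniteDimensional k K] (h : IsRadicalOver k K A) :
    IsGeneratedBySupersolvable k A := by
  obtain ⟨L, _, _, _, _, _, t, hL, htrad, -, -, ι, u, hbij, hu, hut⟩ := h
  have : FiniteDimensional k L := FiniteDimensional.trans k K L
  obtain ⟨S₀, hS₀rad, hS₀fin, hS₀span⟩ := hL.exists_finite_span_eq_top
  have hrad : S₀ ∪ Set.range t ⊆ radGroup k L :=
    Set.union_subset hS₀rad (Set.range_subset_iff.2 htrad)
  obtain ⟨ζ, hζ, hS⟩ := exists_isKummerSystem (K := K) (hS₀fin.union (Set.finite_range t)) hrad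
  set S := insert ζ (S₀ ∪ Set.range t)
  have hSfin : S.Finite := (hS₀fin.union (Set.finite_range t)).insert ζ
  have hSspan : Submodule.span k (Units.val '' S) = ⊤ := by
    refine top_le_iff.1 (hS₀span.ge.trans (Submodule.span_mono (Set.image_mono ?_)))
    exact Set.subset_union_left.trans (Set.subset_insert _ _)
  have hind (σ) : Induces ι (u σ) σ := hu σ
  have hconj : ∀ σ, ∀ x ∈ (Subgroup.closure S).map (Units.map (ι : L →* A)),
      u σ * x * (u σ)⁻¹ ∈ (Subgroup.closure S).map (Units.map (ι : L →* A)) := by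
    rintro σ _ ⟨m, hm, rfl⟩
    exact ⟨σ • m, hS.smul_mem_closure σ hm, ((hind σ).conj_map m).symm⟩
  have hmul (σ τ) : u σ * u τ * (u (σ * τ))⁻¹ ∈
      (Subgroup.closure S).map (Units.map (ι : L →* A)) :=
    ⟨t (σ, τ), Subgroup.subset_closure (Or.inr (Or.inr ⟨_, rfl⟩)),
      eq_mul_inv_iff_mul_eq.2 (Units.ext (hut σ τ).symm)⟩
  refine ⟨crossedSubgroup _ u hconj hmul, hS.isSupersolvable_crossedSubgroup hSfin hSspan hind,
    ⟨relIndex_crossedSubgroup_ne_zero hSfin (Set.insert_subset hζ hrad) hind⟩,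
    adjoin_crossedSubgroup_eq_top hSspan hbij.2⟩

section Corner

variable {R A : Type*} [CommRing R] [Ring A] [Algebra R A] {e : A} (he : IsIdempotentElem e)

theorem mul_coe_corner {he : IsIdempotentElem e} (x : he.Corner) : e * x.1 = x.1 :=
  ((Subsemigroup.mem_corner_iff he).1 x.2).1

theorem coe_corner_mul {he : IsIdempotentElem e} (x : he.Corner) : x.1 * e = x.1 :=
  ((Subsemigroup.mem_corner_iff he).1 x.2).2

/-- The inclusion of the corner `e * A * e` in `A`; it does not preserve `1`. -/
def cornerInclusion : he.Corner →+ A where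
  toFun := Subtype.val
  map_zero' := rfl
  map_add' _ _ := rfl

instance : SMul R he.Corner where
  smul r x := ⟨r • x.1, (Subsemigroup.mem_corner_iff he).2
    ⟨by rw [mul_smul_comm, mul_coe_corner], by rw [smul_mul_assoc, coe_corner_mul]⟩⟩

instance : Module R he.Corner :=
  Subtype.val_injective.module R (cornerInclusion he) fun _ _ => rfl

instance : Algebra R he.Corner :=
  Algebra.ofModule (fun r x y => Subtype.ext (smul_mul_assoc r x.1 y.1))
    fun r x y => Subtype.ext (mul_smul_comm r x.1 y.1)

instance {S : Type*} [CommRing S] [Algebra R S] [Algebra S A] [IsScalarTower R S A] :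
    IsScalarTower R S he.Corner :=
  ⟨fun r s x => Subtype.ext (smul_assoc r s x.1)⟩

variable (R) in
/-- The compression `a ↦ e * a * e` of `A` to the corner. -/
def compression : A →ₗ[R] he.Corner where
  toFun a := ⟨e * a * e, a, rfl⟩
  map_add' a b := Subtype.ext (show e * (a + b) * e = e * a * e + e * b * e by
    rw [mul_add, add_mul])
  map_smul' r a := Subtype.ext (show e * (r • a) * e = r • (e * a * e) by
    rw [mul_smul_comm, smul_mul_assoc])

variable (R) in
theorem compression_surjective : Function.Surjective (compression R he) := fun x =>
  ⟨x.1, Subtype.ext (show e * x.1 * e = x.1 by rw [mul_coe_corner, coe_corner_mul])⟩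

instance [Module.Finite R A] : Module.Finite R he.Corner :=
  Module.Finite.of_surjective _ (compression_surjective R he)

variable {he} {I : Type*} [Fintype I] {ε : I → A} {g : I → Aˣ}

theorem sum_mul_mul_inv (hε : CompleteOrthogonalIdempotents ε)
    (hg : ∀ i, SemiconjBy (g i : A) e (ε i)) : ∑ i, (g i * e * ↑(g i)⁻¹ : A) = 1 := by
  rw [← hε.complete]
  exact Finset.sum_congr rfl fun i _ => (Units.mul_inv_eq_iff_eq_mul _).2 (hg i).eq

variable [DecidableEq I]

omit [Fintype I] in
theorem mul_inv_mul_mul_eq_ite (hε : OrthogonalIdempotents ε) (he : IsIdempotentElem e)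
    (hg : ∀ i, SemiconjBy (g i : A) e (ε i)) (i j : I) :
    e * (↑(g i)⁻¹ * g j) * e = if i = j then e else 0 := by
  split_ifs with hij
  · rw [hij, Units.inv_mul, mul_one, he.eq]
  · calc e * (↑(g i)⁻¹ * g j) * e = ↑(g i)⁻¹ * (ε i * ε j) * g j := by
          rw [← mul_assoc, ← (hg i).units_inv_symm_left.eq, mul_assoc, (hg j).eq]
          simp only [mul_assoc]
      _ = 0 := by rw [hε.ortho hij, mul_zero, zero_mul]

variable (R) in
/-- The Peirce decomposition `a ↦ (e * (g i)⁻¹ * a * g j * e)` of `A`, with values in the matrices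
over the corner `e * A * e`, when `1` is the sum of the orthogonal conjugates `ε i` of `e`. -/
def peirceHom (he : IsIdempotentElem e) (hε : CompleteOrthogonalIdempotents ε)
    (hg : ∀ i, SemiconjBy (g i : A) e (ε i)) : A →ₐ[R] Matrix I I he.Corner :=
  AlgHom.ofLinearMap
    { toFun := fun a => Matrix.of fun i j => compression R he (↑(g i)⁻¹ * a * g j)
      map_add' := fun a b => by
        ext i j
        simp only [mul_add, add_mul, map_add, Matrix.of_apply, Matrix.add_apply]
      map_smul' := fun r a => by
        ext i j
        simp only [mul_smul_comm, smul_mul_assoc, map_smul, Matrix.of_apply, Matrix.smul_apply,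
          RingHom.id_apply] }
    (by
      ext i j
      refine Subtype.ext ?_
      change e * (↑(g i)⁻¹ * 1 * g j) * e = _
      rw [mul_one, mul_inv_mul_mul_eq_ite hε.toOrthogonalIdempotents he hg, Matrix.one_apply]
      split_ifs <;> rfl)
    fun a b => by
      ext i j
      rw [Matrix.mul_apply]
      refine Subtype.ext (Eq.trans ?_ (map_sum (cornerInclusion he) _ _).symm)
      calc e * (↑(g i)⁻¹ * (a * b) * g j) * e
          = e * ↑(g i)⁻¹ * a * (∑ l, g l * (e * e) * ↑(g l)⁻¹) * (b * g j * e) := by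
            rw [he.eq, sum_mul_mul_inv hε hg]
            simp only [mul_assoc, mul_one]
        _ = ∑ l, e * (↑(g i)⁻¹ * a * g l) * e * (e * (↑(g l)⁻¹ * b * g j) * e) := by
            simp only [Finset.mul_sum, Finset.sum_mul, mul_assoc]

variable (R) in
theorem peirceHom_apply (he : IsIdempotentElem e) (hε : CompleteOrthogonalIdempotents ε)
    (hg : ∀ i, SemiconjBy (g i : A) e (ε i)) (a : A) (i j : I) :
    (peirceHom R he hε hg a i j).1 = e * (↑(g i)⁻¹ * a * g j) * e := rfl

variable (he : IsIdempotentElem e) (hε : CompleteOrthogonalIdempotents ε)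
  (hg : ∀ i, SemiconjBy (g i : A) e (ε i))

theorem peirceHom_injective : Function.Injective (peirceHom R he hε hg) := by
  refine (injective_iff_map_eq_zero _).2 fun a ha => ?_
  have hentry (i j) : e * (↑(g i)⁻¹ * a * g j) * e = 0 := by
    rw [← peirceHom_apply R he hε hg, ha]
    rfl
  calc a = (∑ i, g i * e * ↑(g i)⁻¹) * a * ∑ j, g j * e * ↑(g j)⁻¹ := by
        rw [sum_mul_mul_inv hε hg, one_mul, mul_one]
    _ = ∑ i, ∑ j, g i * (e * (↑(g i)⁻¹ * a * g j) * e) * ↑(g j)⁻¹ := by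
        simp only [Finset.sum_mul, Finset.mul_sum, mul_assoc]
        exact Finset.sum_comm
    _ = 0 := by simp only [hentry, mul_zero, zero_mul, Finset.sum_const_zero]

theorem peirceHom_surjective : Function.Surjective (peirceHom R he hε hg) := by
  intro M
  refine ⟨∑ p, ∑ q, g p * (M p q).1 * ↑(g q)⁻¹, ?_⟩
  ext i j
  refine Subtype.ext ?_
  have hM (p q) : (M p q).1 = e * (M p q).1 * e := by rw [mul_coe_corner, coe_corner_mul]
  calc e * (↑(g i)⁻¹ * (∑ p, ∑ q, g p * (M p q).1 * ↑(g q)⁻¹) * g j) * e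
      = ∑ p, ∑ q, e * (↑(g i)⁻¹ * g p) * e * (M p q).1 * (e * (↑(g q)⁻¹ * g j) * e) := by
        simp only [Finset.mul_sum, Finset.sum_mul]
        refine Finset.sum_congr rfl fun p _ => Finset.sum_congr rfl fun q _ => ?_
        conv_lhs => rw [hM p q]
        conv_rhs => rw [hM p q]
        simp only [mul_assoc, he.mul_self_mul]
    _ = (M i j).1 := by
        simp only [mul_inv_mul_mul_eq_ite hε.toOrthogonalIdempotents he hg, ite_mul, zero_mul,
          mul_ite, mul_zero, Finset.sum_ite_eq, Finset.sum_ite_eq', Finset.mem_univ, if_true,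
          mul_coe_corner, coe_corner_mul]

end Corner

theorem isGeneratedBySupersolvable_of_hom {k A G : Type*} [Field k] [Ring A] [Algebra k A]
    [Group G] {ρ : G →* Aˣ} (hG : IsSupersolvable G)
    (hfin : ((scalarUnits k A).comap ρ).FiniteIndex)
    (hgen : Algebra.adjoin k (Units.val '' (ρ.range : Set Aˣ)) = ⊤) :
    IsGeneratedBySupersolvable k A := by
  refine ⟨ρ.range, hG.of_surjective ρ.rangeRestrict_surjective, ⟨?_⟩, hgen⟩
  rw [← Subgroup.index_comap_of_surjective _ ρ.rangeRestrict_surjective]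
  exact hfin.index_ne_zero

section ConjugationAction

variable {k K A G : Type*} [Field k] [Ring A] [Algebra k A] [Group G] [MulSemiringAction G A]
  {ρ : G →* Aˣ}

theorem commute_of_smul_eq_self (hρ : ∀ g a, SemiconjBy (ρ g : A) a (g • a))
    (hgen : Algebra.adjoin k (Units.val '' (ρ.range : Set Aˣ)) = ⊤) {z : A}
    (hz : ∀ g : G, g • z = z) (a : A) : Commute a z := by
  have hle : Algebra.adjoin k (Units.val '' (ρ.range : Set Aˣ)) ≤ Subalgebra.centralizer k {z} := by
    refine Algebra.adjoin_le ?_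
    rintro _ ⟨_, ⟨g, rfl⟩, rfl⟩ z' rfl
    exact ((hρ g z').eq.trans (by rw [hz g])).symm
  exact ((hle (hgen ▸ Algebra.mem_top : a ∈ _)) z rfl).symm

theorem eq_zero_of_mul_eq_zero_of_smul_mem [IsSimpleRing A]
    (hρ : ∀ g a, SemiconjBy (ρ g : A) a (g • a))
    (hgen : Algebra.adjoin k (Units.val '' (ρ.range : Set Aˣ)) = ⊤) {S : Set A}
    (hS : ∀ g : G, ∀ s ∈ S, g • s ∈ S) {a s : A} (ha : ∀ s ∈ S, a * s = 0) (hs : s ∈ S)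
    (hs0 : s ≠ 0) : a = 0 := by
  have mul_mul_eq_zero {a} (ha : ∀ s ∈ S, a * s = 0) (c : A) : ∀ s ∈ S, a * c * s = 0 := by
    have hc : c ∈ Submodule.span k (Units.val '' (ρ.range : Set Aˣ)) :=
      span_units_eq_top hgen ▸ Submodule.mem_top
    intro s hs
    induction hc using Submodule.span_induction with
    | mem c hc =>
      obtain ⟨_, ⟨g, rfl⟩, rfl⟩ := hc
      rw [mul_assoc, (hρ g s).eq, ← mul_assoc, ha _ (hS g s hs), zero_mul]
    | zero => rw [mul_zero, zero_mul]
    | add c d _ _ hc hd => rw [mul_add, add_mul, hc, hd, add_zero]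
    | smul r c _ hc => rw [mul_smul_comm, smul_mul_assoc, hc, smul_zero]
  let I : TwoSidedIdeal A := TwoSidedIdeal.mk' {a | ∀ s ∈ S, a * s = 0}
    (fun s _ => zero_mul s)
    (fun {a b} ha hb s hs => by rw [add_mul, ha s hs, hb s hs, add_zero])
    (fun {a} ha s hs => by rw [neg_mul, ha s hs, neg_zero])
    (fun {a b} hb s hs => by rw [mul_assoc, hb s hs, mul_zero])
    (fun {a b} ha => mul_mul_eq_zero ha b)
  have mem_I {a} : a ∈ I ↔ ∀ s ∈ S, a * s = 0 := TwoSidedIdeal.mem_mk' ..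
  rcases eq_bot_or_eq_top I with hI | hI
  · exact (TwoSidedIdeal.mem_bot A).1 (hI ▸ mem_I.2 ha)
  · exact absurd (one_mul s ▸ mem_I.1 (hI ▸ trivial : (1 : A) ∈ I) s hs) hs0

theorem exists_ne_zero_mul_eq_zero_of_isNilpotent (B : Type*) [CommRing B] [Nontrivial B]
    [IsNoetherianRing B] : ∃ y : B, y ≠ 0 ∧ ∀ x, IsNilpotent x → y * x = 0 := by
  have hnil := IsNoetherianRing.isNilpotent_nilradical B
  obtain ⟨y, hy, hy0⟩ := Submodule.exists_mem_ne_zero_of_ne_bot (pow_pred_nilpotencyClass hnil)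
  refine ⟨y, hy0, fun x hx => ?_⟩
  have := Ideal.mul_mem_mul hy (mem_nilradical.2 hx)
  rwa [← pow_succ, Nat.sub_add_cancel (pos_nilpotencyClass_iff.2 hnil),
    pow_nilpotencyClass hnil] at this

open scoped IsMulCommutative in
theorem isReduced_of_smul_mem [IsSimpleRing A] [Field K] [Algebra K A] [FiniteDimensional K A]
    (hρ : ∀ g a, SemiconjBy (ρ g : A) a (g • a))
    (hgen : Algebra.adjoin k (Units.val '' (ρ.range : Set Aˣ)) = ⊤) (B : Subalgebra K A)
    [IsMulCommutative B] (hB : ∀ g : G, ∀ b ∈ B, g • b ∈ B) : IsReduced B := by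
  have : IsNoetherianRing B := IsNoetherianRing.of_finite K B
  obtain ⟨y, hy0, hy⟩ := exists_ne_zero_mul_eq_zero_of_isNilpotent B
  refine ⟨fun x hx => by_contra fun hx0 => hy0 (Subtype.ext ?_)⟩
  refine eq_zero_of_mul_eq_zero_of_smul_mem hρ hgen (S := {b | b ∈ B ∧ IsNilpotent b})
    (fun g b hb => ⟨hB g b hb.1, hb.2.map (MulSemiringAction.toRingHom G A g)⟩)
    (fun b hb => ?_) ⟨x.2, hx.map B.val⟩ (by simpa using hx0)
  exact congrArg Subtype.val (hy ⟨b, hb.1⟩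
    ((IsNilpotent.map_iff (f := B.val) Subtype.val_injective).1 hb.2))

theorem exists_isIdempotentElem_of_not_isField {B : Type*} [CommRing B] [Nontrivial B]
    [IsArtinianRing B] [IsReduced B] (hB : ¬ IsField B) :
    ∃ e : B, IsIdempotentElem e ∧ e ≠ 0 ∧ e ≠ 1 ∧
      ∀ f, IsIdempotentElem f → e * f = 0 ∨ e * f = e := by
  classical
  obtain ⟨m⟩ : Nonempty (MaximalSpectrum B) := inferInstance
  let φ := IsArtinianRing.equivPi B
  let e : ∀ I : MaximalSpectrum B, B ⧸ I.asIdeal := Pi.single m 1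
  have single_mul (f : B) : e * φ f = Pi.single m (φ f m) := by
    rw [← Pi.single_mul_left, one_mul]
  refine ⟨φ.symm e, ?_, ?_, fun he1 => hB ?_, fun f hf => ?_⟩
  · refine φ.injective ?_
    rw [map_mul, φ.apply_symm_apply, ← Pi.single_mul, mul_one]
  · rw [Ne, map_eq_zero_iff φ.symm φ.symm.injective, Pi.single_eq_zero_iff]
    exact one_ne_zero
  · have : IsLocalRing B := IsLocalRing.of_unique_max_ideal ⟨m.asIdeal, m.isMaximal, fun J hJ => ?_⟩
    · exact IsArtinianRing.isField_of_isReduced_of_isLocalRing B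
    · by_contra hne
      have he1' : e ⟨J, hJ⟩ = 1 := by
        rw [← φ.apply_symm_apply e, he1, map_one, Pi.one_apply]
      have he0 : e ⟨J, hJ⟩ = 0 :=
        Pi.single_eq_of_ne (fun h => hne (congrArg MaximalSpectrum.asIdeal h)) 1
      exact zero_ne_one (he0.symm.trans he1')
  · have hfm : IsIdempotentElem (φ f m) := congrFun ((hf.map φ).eq) m
    have := IsIdempotentElem.iff_eq_zero_or_one.1 hfm
    refine this.imp (fun h => φ.injective ?_) (fun h => φ.injective ?_) <;>
      rw [map_mul, φ.apply_symm_apply, single_mul, h]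
    rw [Pi.single_zero, map_zero]

theorem smul_eq_self_or_mul_smul_eq_zero {e : A} (he0 : e ≠ 0) (hcomm : ∀ g : G, Commute e (g • e))
    (hmin : ∀ g : G, e * g • e = 0 ∨ e * g • e = e) (g : G) : g • e = e ∨ e * g • e = 0 := by
  refine (hmin g).symm.imp_left fun h => ?_
  have hg : g • (e * g⁻¹ • e) = e := by
    rw [smul_mul', smul_inv_smul, ← (hcomm g).eq, h]
  rcases hmin g⁻¹ with h' | h' <;> rw [h'] at hg
  · exact absurd (hg.symm.trans (smul_zero g)) he0
  · exact hg

section Orbit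

variable {e : A} (he : IsIdempotentElem e)
  (hdich : ∀ g : G, g • e = e ∨ e * g • e = 0)

include he hdich

theorem orthogonalIdempotents_orbit :
    OrthogonalIdempotents (Subtype.val : MulAction.orbit G e → A) where
  idem := by
    rintro ⟨_, g, rfl⟩
    exact he.map (MulSemiringAction.toRingHom G A g)
  ortho := by
    rintro ⟨_, g, rfl⟩ ⟨_, h, rfl⟩ hne
    have : g • e * h • e = g • (e * (g⁻¹ * h) • e) := by
      rw [smul_mul', mul_smul, smul_inv_smul]
    change g • e * h • e = 0
    rcases hdich (g⁻¹ * h) with h' | h'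
    · refine absurd (Subtype.ext ?_) hne
      rwa [mul_smul, inv_smul_eq_iff, eq_comm] at h'
    · rw [this, h', smul_zero]

theorem completeOrthogonalIdempotents_orbit [Field K] [Algebra K A] [Algebra.IsCentral K A]
    (hρ : ∀ g a, SemiconjBy (ρ g : A) a (g • a))
    (hgen : Algebra.adjoin k (Units.val '' (ρ.range : Set Aˣ)) = ⊤)
    [Fintype (MulAction.orbit G e)] (he0 : e ≠ 0) :
    CompleteOrthogonalIdempotents (Subtype.val : MulAction.orbit G e → A) where
  toOrthogonalIdempotents := orthogonalIdempotents_orbit he hdich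
  complete := by
    set s := ∑ x : MulAction.orbit G e, (x : A)
    have hs (g : G) : g • s = s := by
      rw [Finset.smul_sum]
      exact Equiv.sum_comp (MulAction.toPerm g) (Subtype.val : MulAction.orbit G e → A)
    obtain ⟨c, hc⟩ : ∃ c, algebraMap K A c = s := Algebra.mem_bot.1 <| Algebra.IsCentral.out <|
      Subalgebra.mem_center_iff.2 (commute_of_smul_eq_self hρ hgen hs)
    have hes : e * s = e :=
      (orthogonalIdempotents_orbit he hdich).mul_sum_of_mem
        (i := ⟨e, MulAction.mem_orbit_self e⟩) (Finset.mem_univ _)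
    have hce : (c - 1) • e = 0 := by
      rw [sub_smul, one_smul, Algebra.smul_def, Algebra.commutes, hc, hes, sub_self]
    rw [← hc, sub_eq_zero.1 ((smul_eq_zero.1 hce).resolve_right he0), map_one]

end Orbit

section CornerUnits

variable {e : A} (he : IsIdempotentElem e) (hρ : ∀ g a, SemiconjBy (ρ g : A) a (g • a))

/-- The homomorphism `g ↦ e * ρ g * e` from the stabilizer of `e` to the units of the corner. -/
def cornerUnits : MulAction.stabilizer G e →* he.Cornerˣ :=
  MonoidHom.toHomUnits
    { toFun := fun g => compression k he (ρ g : A)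
      map_one' := Subtype.ext (show e * (ρ (1 : G) : A) * e = e by
        rw [map_one, Units.val_one, mul_one, he.eq])
      map_mul' := fun g h => Subtype.ext (by
        have hg : (ρ g : A) * e = e * ρ g := (hρ g e).eq.trans (by rw [g.2])
        change e * (ρ (g * h : G) : A) * e = e * ρ g * e * (e * ρ h * e)
        calc e * (ρ (g * h : G) : A) * e = e * ρ g * ρ h * e := by
              rw [map_mul, Units.val_mul, mul_assoc e (ρ g : A)]
          _ = e * (ρ g * e) * ρ h * e := by rw [hg, he.mul_self_mul]
          _ = e * ρ g * e * (e * ρ h * e) := by simp only [mul_assoc, he.mul_self_mul]) }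

include hρ in
theorem isGeneratedBySupersolvable_corner (hG : IsSupersolvable G)
    (hfin : ((scalarUnits k A).comap ρ).FiniteIndex)
    (hgen : Algebra.adjoin k (Units.val '' (ρ.range : Set Aˣ)) = ⊤)
    (hdich : ∀ g : G, g • e = e ∨ e * g • e = 0) : IsGeneratedBySupersolvable k he.Corner := by
  set φ := cornerUnits (k := k) he hρ
  refine isGeneratedBySupersolvable_of_hom (ρ := φ)
    (hG.of_injective (MulAction.stabilizer G e).subtype_injective) ?_ ?_
  · have hle : ((scalarUnits k A).comap ρ).subgroupOf (MulAction.stabilizer G e) ≤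
        (scalarUnits k he.Corner).comap φ := by
      rintro g ⟨c, hc⟩
      refine ⟨c, Units.ext (Subtype.ext ?_)⟩
      have hc' : algebraMap k A c = ρ g := congrArg Units.val hc
      change (c : k) • e = e * ρ g * e
      rw [← hc', ← Algebra.commutes, mul_assoc, he.eq, Algebra.smul_def]
    exact Subgroup.finiteIndex_of_le hle
  · have hle : Submodule.span k (Units.val '' (ρ.range : Set Aˣ)) ≤
        (Subalgebra.toSubmodule (Algebra.adjoin k (Units.val '' (φ.range : Set he.Cornerˣ)))).comap
          (compression k he) := by
      rw [Submodule.span_le]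
      rintro _ ⟨_, ⟨g, rfl⟩, rfl⟩
      rcases hdich g with hg | hg
      · exact Algebra.subset_adjoin ⟨φ ⟨g, hg⟩, ⟨_, rfl⟩, rfl⟩
      · have hzero : compression k he (ρ g : A) = 0 := Subtype.ext <| by
          change e * ρ g * e = 0
          rw [mul_assoc, (hρ g e).eq, ← mul_assoc, hg, zero_mul]
        rw [SetLike.mem_coe, Submodule.mem_comap, hzero]
        exact zero_mem _
    refine Algebra.eq_top_iff.2 fun x => ?_
    obtain ⟨a, rfl⟩ := compression_surjective k he x
    exact hle (span_units_eq_top hgen ▸ Submodule.mem_top)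

end CornerUnits

theorem finiteIndex_stabilizer (hρ : ∀ g a, SemiconjBy (ρ g : A) a (g • a))
    (hfin : ((scalarUnits k A).comap ρ).FiniteIndex) (a : A) :
    (MulAction.stabilizer G a).FiniteIndex := by
  refine Subgroup.finiteIndex_of_le (H := (scalarUnits k A).comap ρ) ?_
  rintro g ⟨c, hc⟩
  have hc' : algebraMap k A c = ρ g := congrArg Units.val hc
  refine (ρ g).isUnit.mul_right_cancel ?_
  rw [← (hρ g a).eq, ← hc', Algebra.commutes]

open scoped IsMulCommutative in
theorem exists_corner_of_not_isField [Field K] [Algebra K A] [FiniteDimensional K A]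
    [Algebra.IsCentral K A] [IsSimpleRing A] (hG : IsSupersolvable G)
    (hfin : ((scalarUnits k A).comap ρ).FiniteIndex)
    (hgen : Algebra.adjoin k (Units.val '' (ρ.range : Set Aˣ)) = ⊤)
    (hρ : ∀ g a, SemiconjBy (ρ g : A) a (g • a)) (B : Subalgebra K A) [IsMulCommutative B]
    (hB : ∀ g : G, ∀ b ∈ B, g • b ∈ B) (hfield : ¬ IsField B) :
    ∃ (e : A) (he : IsIdempotentElem e) (n : ℕ), 1 < n ∧
      Nonempty (A ≃ₐ[K] Matrix (Fin n) (Fin n) he.Corner) ∧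
      IsGeneratedBySupersolvable k he.Corner := by
  classical
  have : IsArtinianRing B := IsArtinianRing.of_finite K B
  have := isReduced_of_smul_mem hρ hgen B hB
  obtain ⟨⟨e, heB⟩, heB', he0, he1, hmin⟩ := exists_isIdempotentElem_of_not_isField hfield
  have he : IsIdempotentElem e := heB'.map B.val
  have he0 : e ≠ 0 := fun h => he0 (Subtype.ext h)
  have hdich (g : G) : g • e = e ∨ e * g • e = 0 := by
    refine smul_eq_self_or_mul_smul_eq_zero he0
      (fun g => congrArg Subtype.val (mul_comm (⟨e, heB⟩ : B) ⟨g • e, hB g e heB⟩))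
      (fun g => (hmin ⟨g • e, hB g e heB⟩ ?_).imp (congrArg Subtype.val) (congrArg Subtype.val)) g
    exact Subtype.ext (he.map (MulSemiringAction.toRingHom G A g))
  have := finiteIndex_stabilizer hρ hfin e
  have : Finite (MulAction.orbit G e) :=
    .of_equiv _ (MulAction.orbitEquivQuotientStabilizer G e).symm
  have := Fintype.ofFinite (MulAction.orbit G e)
  have hε := completeOrthogonalIdempotents_orbit he hdich hρ hgen (K := K) he0
  choose γ hγ using fun x : MulAction.orbit G e => x.2
  have hγ' (x : MulAction.orbit G e) : SemiconjBy (ρ (γ x) : A) e x := hγ x ▸ hρ (γ x) e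
  refine ⟨e, he, _, ?_, ⟨(AlgEquiv.ofBijective (peirceHom K he hε hγ')
    ⟨peirceHom_injective he hε hγ', peirceHom_surjective he hε hγ'⟩).trans
      (Matrix.reindexAlgEquiv K _ (Fintype.equivFin _))⟩,
    isGeneratedBySupersolvable_corner he hρ hG hfin hgen hdich⟩
  by_contra! hcard
  have := Fintype.card_le_one_iff_subsingleton.1 hcard
  have := hε.complete
  rw [Fintype.sum_subsingleton _ ⟨e, MulAction.mem_orbit_self e⟩] at this
  exact he1 (Subtype.ext this)

end ConjugationAction

section MatrixDescent

variable {K C I : Type*} [Ring C] [Fintype I] [Nonempty I]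

theorem isSimpleRing_of_matrix [IsSimpleRing (Matrix I I C)] : IsSimpleRing C where
  simple := letI := Classical.decEq I; TwoSidedIdeal.orderIsoMatrix (n := I) |>.isSimpleOrder

theorem isCentral_of_matrix [Field K] [Algebra K C] [DecidableEq I]
    [h : Algebra.IsCentral K (Matrix I I C)] : Algebra.IsCentral K C where
  out z hz := by
    obtain ⟨i⟩ := ‹Nonempty I›
    have hcenter : Matrix.scalar I z ∈ Subalgebra.center K (Matrix I I C) :=
      Subalgebra.mem_center_iff.2 fun M =>
        (Matrix.scalar_commute z (fun r => (Subalgebra.mem_center_iff.1 hz r).symm) M).symm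
    obtain ⟨c, hc⟩ := Algebra.mem_bot.1 (h.out hcenter)
    refine Algebra.mem_bot.2 ⟨c, ?_⟩
    simpa [Matrix.algebraMap_matrix_apply] using congrFun (congrFun hc i) i

end MatrixDescent

section CrossedProduct

variable {k K L A : Type*} [Field k] [Field K] [Field L] [Algebra K L] [Ring A] [Algebra K A]
  {ι : L →ₐ[K] A}

theorem mem_range_map_of_mem_range [Nontrivial A] {x : Aˣ} (hx : (x : A) ∈ ι.range) :
    x ∈ (Units.map (ι : L →* A)).range := by
  obtain ⟨l, hl⟩ := hx
  have hl0 : l ≠ 0 := fun h => x.ne_zero (hl.symm.trans (h ▸ map_zero ι))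
  exact ⟨Units.mk0 l hl0, Units.ext hl⟩

theorem conj_mem_adjoin {N : Subgroup Aˣ} {γ : Aˣ} (hγ : ∀ x ∈ N, γ * x * γ⁻¹ ∈ N) {b : A}
    (hb : b ∈ Algebra.adjoin K (Units.val '' (N : Set Aˣ))) :
    γ * b * ↑γ⁻¹ ∈ Algebra.adjoin K (Units.val '' (N : Set Aˣ)) := by
  suffices Algebra.adjoin K (Units.val '' (N : Set Aˣ)) ≤
      (Algebra.adjoin K (Units.val '' (N : Set Aˣ))).comap
        (MulSemiringAction.toAlgHom K A (ConjAct.toConjAct γ)) from this hb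
  refine Algebra.adjoin_le ?_
  rintro _ ⟨x, hx, rfl⟩
  exact Algebra.subset_adjoin ⟨_, hγ x hx, rfl⟩

theorem mem_normalizingUnits_of_conj_mem_range [FiniteDimensional K L] [Nontrivial A] {γ : Aˣ}
    (hγ : ∀ l, γ * ι l * ↑γ⁻¹ ∈ ι.range) : γ ∈ normalizingUnits ι := by
  let f : L →ₐ[K] L := (AlgEquiv.ofInjectiveField ι).symm.toAlgHom.comp
    (((MulSemiringAction.toAlgHom K A (ConjAct.toConjAct γ)).comp ι).codRestrict ι.range hγ)
  have hf (l : L) : ι (f l) = γ * ι l * ↑γ⁻¹ :=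
    congrArg Subtype.val ((AlgEquiv.ofInjectiveField ι).apply_symm_apply ⟨_, hγ l⟩)
  refine ⟨AlgEquiv.ofBijective f f.bijective, fun l => ?_⟩
  change γ * ι l = ι (f l) * γ
  rw [hf, Units.inv_mul_cancel_right]

section Galois

variable [Nontrivial A] [Algebra.IsCentral K A] [Algebra k A] {Γ : Subgroup Aˣ}
  (hΓ : Γ ≤ normalizingUnits ι) (hgen : Algebra.adjoin k (Units.val '' (Γ : Set Aˣ)) = ⊤)

include hΓ hgen

theorem fixedField_map_inducedAut_eq_bot :
    IntermediateField.fixedField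
      ((Γ.subgroupOf (normalizingUnits ι)).map (inducedAut ι)) = ⊥ := by
  refine eq_bot_iff.2 fun l hl => ?_
  have hle : Algebra.adjoin k (Units.val '' (Γ : Set Aˣ)) ≤ Subalgebra.centralizer k {ι l} := by
    refine Algebra.adjoin_le ?_
    rintro _ ⟨γ, hγ, rfl⟩ _ rfl
    have hfix : inducedAut ι ⟨γ, hΓ hγ⟩ l = l :=
      IntermediateField.mem_fixedField_iff _ _ |>.1 hl _ ⟨⟨γ, hΓ hγ⟩, hγ, rfl⟩
    have := induces_inducedAut (ι := ι) ⟨γ, hΓ hγ⟩ l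
    rw [hfix] at this
    exact this.eq.symm
  have hcentral : ι l ∈ Subalgebra.center K A := Subalgebra.mem_center_iff.2 fun a =>
    (hle (hgen ▸ Algebra.mem_top : a ∈ _) _ rfl).symm
  obtain ⟨c, hc⟩ := Algebra.mem_bot.1 (Algebra.IsCentral.out hcentral)
  exact IntermediateField.mem_bot.2 ⟨c, ι.injective ((ι.commutes c).trans hc)⟩

variable [FiniteDimensional K L]

theorem isGalois_of_le_normalizingUnits : IsGalois K L := by
  have hfixed := fixedField_map_inducedAut_eq_bot hΓ hgen
  have htop := IntermediateField.fixingSubgroup_fixedField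
    ((Γ.subgroupOf (normalizingUnits ι)).map (inducedAut ι))
  rw [hfixed, IntermediateField.fixingSubgroup_bot] at htop
  exact IsGalois.of_fixedField_eq_bot K L (htop ▸ hfixed)

theorem exists_mem_induces (σ : L ≃ₐ[K] L) : ∃ γ ∈ Γ, Induces ι γ σ := by
  have htop := IntermediateField.fixingSubgroup_fixedField
    ((Γ.subgroupOf (normalizingUnits ι)).map (inducedAut ι))
  rw [fixedField_map_inducedAut_eq_bot hΓ hgen, IntermediateField.fixingSubgroup_bot] at htop
  obtain ⟨γ, hγ, rfl⟩ := htop ▸ Subgroup.mem_top σ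
  exact ⟨γ, hγ, induces_inducedAut γ⟩

theorem mul_comm_of_commutator_le (hcomm : ⁅Γ, Γ⁆ ≤ (Units.map (ι : L →* A)).range)
    (σ τ : L ≃ₐ[K] L) : σ * τ = τ * σ := by
  obtain ⟨γ, hγ, hσ⟩ := exists_mem_induces hΓ hgen σ
  obtain ⟨δ, hδ, hτ⟩ := exists_mem_induces hΓ hgen τ
  obtain ⟨l, hl⟩ := hcomm (Subgroup.commutator_mem_commutator hγ hδ)
  have : Induces ι ⁅γ, δ⁆ ⁅σ, τ⁆ := ((hσ.mul hτ).mul hσ.inv).mul hτ.inv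
  exact commutatorElement_eq_one_iff_mul_comm.1 (this.unique (hl ▸ induces_map l))

end Galois

theorem isMulCocycle₂_of_mul_eq [Nontrivial A] {u : (L ≃ₐ[K] L) → Aˣ}
    (hu : ∀ σ, Induces ι (u σ) σ) {t : (L ≃ₐ[K] L) × (L ≃ₐ[K] L) → Lˣ}
    (ht : ∀ σ τ, u σ * u τ = Units.map (ι : L →* A) (t (σ, τ)) * u (σ * τ)) :
    groupCohomology.IsMulCocycle₂ t := by
  intro σ τ ρ
  refine Units.map_injective (f := (ι : L →* A)) ι.injective
    (mul_right_cancel (b := u (σ * τ * ρ)) ?_)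
  calc Units.map (ι : L →* A) (t (σ * τ, ρ) * t (σ, τ)) * u (σ * τ * ρ)
      = Units.map (ι : L →* A) (t (σ, τ)) *
          (Units.map (ι : L →* A) (t (σ * τ, ρ)) * u (σ * τ * ρ)) := by
        rw [mul_comm (t _), map_mul, mul_assoc]
    _ = u σ * u τ * u ρ := by rw [← ht, ← mul_assoc, ← ht]
    _ = u σ * Units.map (ι : L →* A) (t (τ, ρ)) * u (τ * ρ) := by
        rw [mul_assoc, ht τ ρ, mul_assoc]
    _ = Units.map (ι : L →* A) (σ • t (τ, ρ)) * (u σ * u (τ * ρ)) := by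
        rw [← (hu σ).conj_map, ← mul_assoc _ (u σ), inv_mul_cancel_right]
    _ = Units.map (ι : L →* A) (σ • t (τ, ρ) * t (σ, τ * ρ)) * u (σ * τ * ρ) := by
        rw [ht, map_mul, mul_assoc, mul_assoc σ]

section CrossedSum

variable [FiniteDimensional K L]

/-- The map `(c σ) ↦ ∑ σ, c σ * u σ`, which is bijective exactly when the `u σ` are a left
`L`-basis of `A`. -/
noncomputable def crossedSum (ι : L →ₐ[K] A) (u : (L ≃ₐ[K] L) → Aˣ) : ((L ≃ₐ[K] L) → L) →ₗ[K] A :=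
  ∑ σ, LinearMap.mulRight K (u σ : A) ∘ₗ ι.toLinearMap ∘ₗ LinearMap.proj σ

theorem crossedSum_apply (u : (L ≃ₐ[K] L) → Aˣ) (c : (L ≃ₐ[K] L) → L) :
    crossedSum ι u c = ∑ σ, ι (c σ) * (u σ : A) := by
  simp [crossedSum]

theorem crossedSum_single [DecidableEq (L ≃ₐ[K] L)] (u : (L ≃ₐ[K] L) → Aˣ) (σ : L ≃ₐ[K] L)
    (l : L) : crossedSum ι u (Pi.single σ l) = ι l * u σ := by
  rw [crossedSum_apply, Finset.sum_eq_single σ, Pi.single_eq_same]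
  · intro τ _ h
    rw [Pi.single_eq_of_ne h, map_zero, zero_mul]
  · exact fun h => absurd (Finset.mem_univ σ) h

variable {u : (L ≃ₐ[K] L) → Aˣ} (hu : ∀ σ, Induces ι (u σ) σ)

include hu

theorem crossedSum_injective [Nontrivial A] : Function.Injective (crossedSum ι u) := by
  let _ : Module L A := Module.compHom A (ι : L →+* A)
  have smul_def (l : L) (a : A) : l • a = ι l * a := rfl
  refine (injective_iff_map_eq_zero _).2 fun c hc => funext fun τ => ?_
  obtain ⟨φ, hφ⟩ : ∃ φ : Module.Dual L A, φ (u τ : A) ≠ 0 := by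
    by_contra! h
    exact (u τ).ne_zero ((Module.forall_dual_apply_eq_zero_iff L _).1 h)
  have hmul (x : L) : ∑ σ, (c σ * σ x) • (u σ : A) = 0 := by
    rw [← zero_mul (ι x), ← hc, crossedSum_apply, Finset.sum_mul]
    refine Finset.sum_congr rfl fun σ _ => ?_
    rw [mul_assoc, hu σ x, smul_def, map_mul, mul_assoc]
  have hli : LinearIndependent L (fun σ : L ≃ₐ[K] L => (σ : L → L)) :=
    (linearIndependent_monoidHom L L).comp
      (fun σ : L ≃ₐ[K] L => ((σ : L →ₐ[K] L) : L →* L)) fun σ τ h =>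
        AlgEquiv.ext fun l => congrArg (fun f : L →* L => f l) h
  have hsum : ∑ σ : L ≃ₐ[K] L, (c σ * φ (u σ : A)) • (σ : L → L) = 0 := by
    funext x
    rw [Finset.sum_apply, Pi.zero_apply, ← map_zero φ, ← hmul x, map_sum]
    refine Finset.sum_congr rfl fun σ _ => ?_
    rw [map_smul, Pi.smul_apply, smul_eq_mul, smul_eq_mul, mul_right_comm]
  exact (mul_eq_zero.1 (Fintype.linearIndependent_iff.1 hli _ hsum τ)).resolve_right hφ

variable [Algebra k K] [Algebra k L] [IsScalarTower k K L] [Algebra k A] [IsScalarTower k K A]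
  {Γ : Subgroup Aˣ} (huΓ : ∀ σ, u σ ∈ Γ) (hΓ : Γ ≤ normalizingUnits ι)
  (hspan : Submodule.span k (Units.val '' (Γ : Set Aˣ)) = ⊤)
  (hself : ∀ γ ∈ Γ, Induces ι γ 1 → γ ∈ (Units.map (ι : L →* A)).range)
  {E : Submodule k L} (hE : ∀ l : Lˣ, Units.map (ι : L →* A) l ∈ Γ → (l : L) ∈ E)

include huΓ hΓ hspan hself hE

theorem exists_crossedSum_eq (a : A) : ∃ c, (∀ σ, c σ ∈ E) ∧ crossedSum ι u c = a := by
  classical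
  have hle : Submodule.span k (Units.val '' (Γ : Set Aˣ)) ≤
      (Submodule.pi Set.univ fun _ => E).map ((crossedSum ι u).restrictScalars k) := by
    rw [Submodule.span_le]
    rintro _ ⟨γ, hγ, rfl⟩
    obtain ⟨σ, hσ⟩ := hΓ hγ
    have hmem : γ * (u σ)⁻¹ ∈ Γ := mul_mem hγ (inv_mem (huΓ σ))
    obtain ⟨l, hl⟩ := hself _ hmem (mul_inv_cancel σ ▸ hσ.mul (hu σ).inv)
    refine ⟨Pi.single σ l, fun τ _ => ?_, ?_⟩
    · rcases eq_or_ne τ σ with rfl | h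
      · simpa using hE l (hl ▸ hmem)
      · simp [h]
    · exact (crossedSum_single u σ (l : L)).trans
        (congrArg Units.val (eq_mul_inv_iff_mul_eq.1 hl))
  obtain ⟨c, hc, rfl⟩ := hle (hspan ▸ Submodule.mem_top : a ∈ _)
  exact ⟨c, fun σ => hc σ trivial, rfl⟩

theorem eq_top_of_forall_map_mem [Nontrivial A] : E = ⊤ := by
  classical
  refine Submodule.eq_top_iff'.2 fun l => ?_
  obtain ⟨c, hc, hcl⟩ := exists_crossedSum_eq hu huΓ hΓ hspan hself hE (ι l * u 1)
  rw [← crossedSum_single] at hcl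
  simpa [crossedSum_injective hu hcl] using hc 1

end CrossedSum

theorem mem_radGroup_of_map_mem [Algebra k K] [Algebra k L] [IsScalarTower k K L] [Algebra k A]
    [IsScalarTower k K A] [Nontrivial A] {Γ : Subgroup Aˣ}
    (hfin : ((scalarUnits k A).subgroupOf Γ).FiniteIndex) {l : Lˣ}
    (hl : Units.map (ι : L →* A) l ∈ Γ) : l ∈ radGroup k L := by
  obtain ⟨n, hn, -, c, hc⟩ :=
    Subgroup.exists_pow_mem_of_index_ne_zero hfin.index_ne_zero ⟨_, hl⟩
  refine ⟨n, hn, c, Units.map_injective (f := (ι : L →* A)) ι.injective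
    (.trans ?_ (hc.trans (map_pow _ l n).symm))⟩
  ext
  change ι (algebraMap k L c) = algebraMap k A c
  rw [IsScalarTower.algebraMap_apply k K L, ι.commutes, ← IsScalarTower.algebraMap_apply]

theorem exists_isCrossedProduct [Algebra k K] [Algebra k L] [IsScalarTower k K L] [Algebra k A]
    [IsScalarTower k K A] [FiniteDimensional K L] [Nontrivial A] [Algebra.IsCentral K A]
    {Γ : Subgroup Aˣ} (hfin : ((scalarUnits k A).subgroupOf Γ).FiniteIndex)
    (hgen : Algebra.adjoin k (Units.val '' (Γ : Set Aˣ)) = ⊤) (hΓ : Γ ≤ normalizingUnits ι)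
    (hself : ∀ γ ∈ Γ, Induces ι γ 1 → γ ∈ (Units.map (ι : L →* A)).range) :
    ∃ t : (L ≃ₐ[K] L) × (L ≃ₐ[K] L) → Lˣ,
      IsRadicalExtension k L ∧ (∀ p, t p ∈ radGroup k L) ∧ IsCrossedProduct K L A t := by
  choose u huΓ hu using exists_mem_induces hΓ hgen
  have ht (p : (L ≃ₐ[K] L) × (L ≃ₐ[K] L)) : ∃ l : Lˣ, Units.map (ι : L →* A) l ∈ Γ ∧
      u p.1 * u p.2 = Units.map (ι : L →* A) l * u (p.1 * p.2) := by
    have hmem : u p.1 * u p.2 * (u (p.1 * p.2))⁻¹ ∈ Γ :=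
      mul_mem (mul_mem (huΓ _) (huΓ _)) (inv_mem (huΓ _))
    obtain ⟨l, hl⟩ := hself _ hmem
      (mul_inv_cancel (p.1 * p.2) ▸ ((hu p.1).mul (hu p.2)).mul (hu (p.1 * p.2)).inv)
    exact ⟨l, hl ▸ hmem, (eq_mul_inv_iff_mul_eq.1 hl).symm⟩
  choose t htΓ ht using ht
  have hspan := span_units_eq_top hgen
  have hrad : (IntermediateField.adjoin k
      (Units.val '' (radGroup k L : Set Lˣ))).toSubalgebra.toSubmodule = ⊤ :=
    eq_top_of_forall_map_mem hu huΓ hΓ hspan hself fun l hl =>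
      IntermediateField.subset_adjoin k _ ⟨l, mem_radGroup_of_map_mem hfin hl, rfl⟩
  have hsurj : Function.Surjective (crossedSum ι u) := fun a =>
    (exists_crossedSum_eq hu huΓ hΓ hspan hself (E := ⊤) (fun _ _ => trivial) a).imp
      fun _ => And.right
  refine ⟨t, eq_top_iff.2 fun l _ => Submodule.eq_top_iff'.1 hrad l, fun p =>
    mem_radGroup_of_map_mem hfin (htΓ p), isGalois_of_le_normalizingUnits hΓ hgen,
    isMulCocycle₂_of_mul_eq hu fun σ τ => ht (σ, τ), ι, u, ?_, fun σ l => hu σ l,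
    fun σ τ => congrArg Units.val (ht (σ, τ))⟩
  simp only [← crossedSum_apply]
  exact ⟨crossedSum_injective hu, hsurj⟩

end CrossedProduct

section Primitive

variable {k : Type u} {K : Type v} {A : Type w} [Field k] [Field K] [Ring A] [Algebra K A]
  [Algebra k A] {Γ : Subgroup Aˣ}

variable (K) in
/-- Every abelian normal subgroup of `Γ` generates a field over `K`. When this fails, an idempotent
of a commutative subalgebra splits off a matrix algebra; when it holds, `A` is a crossed product. -/
def AbelianNormalsGenerateFields (Γ : Subgroup Aˣ) : Prop :=
  ∀ N : Subgroup Γ, N.Normal → IsMulCommutative N →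
    IsField (Algebra.adjoin K (Units.val '' (N.map Γ.subtype : Set Aˣ)))

theorem scalarUnits_subgroupOf_le_center (Γ : Subgroup Aˣ) :
    (scalarUnits k A).subgroupOf Γ ≤ Subgroup.center Γ := by
  rintro z ⟨c, hc⟩
  refine Subgroup.mem_center_iff.2 fun g => Subtype.ext (Units.ext ?_)
  have hc' : algebraMap k A c = (z : Aˣ) := congrArg Units.val hc
  change (g : Aˣ) * ((z : Aˣ) : A) = (z : Aˣ) * ((g : Aˣ) : A)
  rw [← hc', Algebra.commutes]

theorem isCyclic_of_isField_adjoin {N : Subgroup Γ} [Finite N]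
    (h : IsField (Algebra.adjoin K (Units.val '' (N.map Γ.subtype : Set Aˣ)))) : IsCyclic N := by
  let _ := h.toField
  let f : N →* Algebra.adjoin K (Units.val '' (N.map Γ.subtype : Set Aˣ)) :=
    ((Units.coeHom A).comp (Γ.subtype.comp N.subtype)).codRestrict _ fun x =>
      Algebra.subset_adjoin ⟨_, ⟨x, x.2, rfl⟩, rfl⟩
  exact isCyclic_of_injective_ringHom f fun x y hxy =>
    Subtype.ext (Subtype.ext (Units.ext (congrArg Subtype.val hxy)))

theorem AbelianNormalsGenerateFields.isMulCommutative_commutator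
    (hfield : AbelianNormalsGenerateFields K Γ) (hΓ : IsSupersolvable Γ)
    (hfin : ((scalarUnits k A).subgroupOf Γ).FiniteIndex) : IsMulCommutative (commutator Γ) := by
  have := finite_commutator_of_finiteIndex_le_center (scalarUnits_subgroupOf_le_center (k := k) Γ)
  obtain ⟨N, hN, hNcomm, -, hND, hself⟩ := hΓ.exists_selfCentralizing (bot_le (a := commutator Γ))
  have : Finite N := .of_injective _ (Subgroup.inclusion_injective hND)
  have : IsCyclic N := isCyclic_of_isField_adjoin (hfield N hN hNcomm)
  have hle : commutator Γ ≤ N :=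
    (le_inf (commutator_le_centralizer_of_isCyclic N) le_rfl).trans hself
  rwa [hND.antisymm hle] at hNcomm

theorem AbelianNormalsGenerateFields.isRadicalAbelianOver [Nontrivial A] [Algebra k K]
    [IsScalarTower k K A] [FiniteDimensional K A] [Algebra.IsCentral K A]
    (hfield : AbelianNormalsGenerateFields K Γ) (hΓ : IsSupersolvable Γ)
    (hfin : ((scalarUnits k A).subgroupOf Γ).FiniteIndex)
    (hgen : Algebra.adjoin k (Units.val '' (Γ : Set Aˣ)) = ⊤) : IsRadicalAbelianOver k K A := by
  have := hfield.isMulCommutative_commutator hΓ hfin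
  obtain ⟨N, hN, hNcomm, hcN, -, hself⟩ := hΓ.exists_selfCentralizing (le_top (a := commutator Γ))
  let L := Algebra.adjoin K (Units.val '' (N.map Γ.subtype : Set Aˣ))
  let _ : Field L := (hfield N hN hNcomm).toField
  let _ : Algebra K L := L.algebra
  let _ : Algebra k L := ((algebraMap K L).comp (algebraMap k K)).toAlgebra
  have : IsScalarTower k K L := .of_algebraMap_eq fun _ => rfl
  let ι : L →ₐ[K] A := L.val
  have : FiniteDimensional K L := FiniteDimensional.of_injective ι.toLinearMap ι.injective
  have hNL : N.map Γ.subtype ≤ (Units.map (ι : L →* A)).range := fun x hx =>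
    mem_range_map_of_mem_range ⟨⟨x, Algebra.subset_adjoin ⟨x, hx, rfl⟩⟩, rfl⟩
  have hΓL : Γ ≤ normalizingUnits ι := fun γ hγ =>
    mem_normalizingUnits_of_conj_mem_range fun l => ⟨⟨_, conj_mem_adjoin (by
      rintro _ ⟨x, hx, rfl⟩
      exact ⟨_, hN.conj_mem x hx ⟨γ, hγ⟩, rfl⟩) l.2⟩, rfl⟩
  obtain ⟨t, ht, htrad, hcross⟩ := exists_isCrossedProduct hfin hgen hΓL fun γ hγ h1 => by
    refine hNL ⟨⟨γ, hγ⟩, hself ⟨fun x hx => ?_, trivial⟩, rfl⟩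
    obtain ⟨l, hl⟩ := hNL ⟨x, hx, rfl⟩
    have hlx : ι l = (x : Aˣ) := congrArg Units.val hl
    refine Subtype.ext (Units.ext ?_)
    change ((x : Aˣ) : A) * γ = γ * (x : Aˣ)
    rw [← hlx]
    exact (h1 l).eq.symm
  refine ⟨L, inferInstance, inferInstance, inferInstance, inferInstance, inferInstance, t, ht,
    htrad, hcross, mul_comm_of_commutator_le hΓL hgen ?_⟩
  rw [← Subgroup.map_subtype_commutator]
  exact (Subgroup.map_mono hcN).trans hNL

theorem exists_corner_of_not_abelianNormalsGenerateFields [FiniteDimensional K A]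
    [Algebra.IsCentral K A] [IsSimpleRing A] (hfield : ¬ AbelianNormalsGenerateFields K Γ)
    (hΓ : IsSupersolvable Γ) (hfin : ((scalarUnits k A).subgroupOf Γ).FiniteIndex)
    (hgen : Algebra.adjoin k (Units.val '' (Γ : Set Aˣ)) = ⊤) :
    ∃ (e : A) (he : IsIdempotentElem e) (n : ℕ), 1 < n ∧
      Nonempty (A ≃ₐ[K] Matrix (Fin n) (Fin n) he.Corner) ∧
      IsGeneratedBySupersolvable k he.Corner := by
  obtain ⟨N, hN, hNcomm, hnot⟩ : ∃ N : Subgroup Γ, N.Normal ∧ IsMulCommutative N ∧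
      ¬ IsField (Algebra.adjoin K (Units.val '' (N.map Γ.subtype : Set Aˣ))) := by
    simpa only [AbelianNormalsGenerateFields, not_forall, exists_prop] using hfield
  let _ : MulSemiringAction Γ A :=
    .compHom A ((ConjAct.toConjAct : Aˣ ≃* ConjAct Aˣ).toMonoidHom.comp Γ.subtype)
  have : IsMulCommutative (Algebra.adjoin K (Units.val '' (N.map Γ.subtype : Set Aˣ))) := by
    refine Algebra.isMulCommutative_adjoin K ?_
    rintro _ ⟨_, ⟨x, hx, rfl⟩, rfl⟩ _ ⟨_, ⟨y, hy, rfl⟩, rfl⟩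
    exact congrArg (fun z : Γ => ((z : Aˣ) : A)) (setLike_mul_comm hx hy)
  refine exists_corner_of_not_isField (ρ := Γ.subtype) hΓ hfin (by rwa [Subgroup.range_subtype])
    (fun γ a => ?_) (Algebra.adjoin K (Units.val '' (N.map Γ.subtype : Set Aˣ)))
    (fun γ b hb => conj_mem_adjoin ?_ hb) hnot
  · exact (Units.inv_mul_cancel_right _ _).symm
  · rintro _ ⟨x, hx, rfl⟩
    exact ⟨_, hN.conj_mem x hx γ, rfl⟩

end Primitive

theorem IsGeneratedBySupersolvable.exists_matrix_isRadicalAbelianOver {k : Type u} {K : Type v}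
    [Field k] [Field K] [Algebra k K] (A : Type w) [Ring A] [Algebra K A] [Algebra k A]
    [IsScalarTower k K A] [FiniteDimensional K A] [Algebra.IsCentral K A] [IsSimpleRing A]
    (h : IsGeneratedBySupersolvable k A) :
    ∃ (n : ℕ) (C : Type w) (_ : Ring C) (_ : Algebra K C),
      0 < n ∧ FiniteDimensional K C ∧ Algebra.IsCentral K C ∧ IsSimpleRing C ∧
        IsRadicalAbelianOver k K C ∧ Nonempty (A ≃ₐ[K] Matrix (Fin n) (Fin n) C) := by
  induction hd : Module.finrank K A using Nat.strong_induction_on generalizing A with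
  | _ d ih =>
  obtain ⟨Γ, hΓ, hfin, hgen⟩ := h
  by_cases hfield : AbelianNormalsGenerateFields K Γ
  · exact ⟨1, A, inferInstance, inferInstance, one_pos, inferInstance, inferInstance,
      inferInstance, hfield.isRadicalAbelianOver hΓ hfin hgen,
      ⟨.ofBijective (Matrix.scalarAlgHom (Fin 1) K) ⟨fun _ _ => Matrix.scalar_inj.1, fun M =>
        ⟨M 0 0, by ext i j; simp [Subsingleton.elim i 0, Subsingleton.elim j 0]⟩⟩⟩⟩
  · obtain ⟨e, he, n, hn, ⟨φ⟩, hcorner⟩ :=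
      exists_corner_of_not_abelianNormalsGenerateFields hfield hΓ hfin hgen
    have : NeZero n := ⟨by omega⟩
    have : IsSimpleRing (Matrix (Fin n) (Fin n) he.Corner) := .of_ringEquiv φ.toRingEquiv ‹_›
    have : IsSimpleRing he.Corner := isSimpleRing_of_matrix (I := Fin n)
    have : Algebra.IsCentral K (Matrix (Fin n) (Fin n) he.Corner) := .of_algEquiv K A _ φ
    have : Algebra.IsCentral K he.Corner := isCentral_of_matrix (I := Fin n)
    have hlt : Module.finrank K he.Corner < d := by
      rw [← hd, φ.toLinearEquiv.finrank_eq, Module.finrank_matrix, Fintype.card_fin]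
      exact lt_mul_of_one_lt_left Module.finrank_pos (one_lt_mul'' hn hn)
    obtain ⟨m, C, _, _, hm, hC, hcentral, hsimple, hrad, ⟨ψ⟩⟩ := ih _ hlt he.Corner hcorner rfl
    exact ⟨n * m, C, inferInstance, inferInstance, Nat.mul_pos (by omega) hm, hC, hcentral,
      hsimple, hrad, ⟨φ.trans (ψ.mapMatrix.trans ((Matrix.compAlgEquiv (Fin n) (Fin m) C K).trans
        (Matrix.reindexAlgEquiv K C finProdFinEquiv)))⟩⟩

theorem theorem1p2 (k : Type u) (K : Type v) (A : Type w) [Field k] [Field K] [Algebra k K]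
    [Ring A] [Algebra K A] [Algebra k A] [IsScalarTower k K A]
    [FiniteDimensional K A] [Algebra.IsCentral K A] [IsSimpleRing A] :
    (FiniteDimensional k K → IsRadicalOver k K A → IsGeneratedBySupersolvable k A) ∧
    (IsGeneratedBySupersolvable k A →
      ∃ (n : ℕ) (C : Type w) (_ : Ring C) (_ : Algebra K C),
        0 < n ∧ FiniteDimensional K C ∧ Algebra.IsCentral K C ∧ IsSimpleRing C ∧
          IsRadicalAbelianOver k K C ∧ Nonempty (A ≃ₐ[K] Matrix (Fin n) (Fin n) C)) :=
  ⟨fun _ h => h.isGeneratedBySupersolvable, fun h => h.exists_matrix_isRadicalAbelianOver⟩
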